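/- Let $k\ge 1$, $K\ge 0$ be integers and ${\cal S}=\{0,\ldots,K\}^k$. Let $(X_i)_{i\in\mathbb N}$, $X_i=(X_{i1},\ldots,X_{ik})$, be a stationary ergodic (that is, irreducible and aperiodic) Markov chain on ${\cal S}$ with transition matrix $P=(p(x,x'))_{(x,x')\in{\cal S}^2}$. Let $(T_i)_{i\in\mathbb N}$ be a nondecreasing sequence of random times with $T_0=0$ and i.i.d. increments $T_i-T_{i-1}$, $i\ge1$; put $\tau=T_1$ and let $N_t$ be the number of indices $i\ge 1$ with $T_i\le t$. Let $(L_{ij})_{i\in\mathbb N,\,1\le j\le k}$ be independent real random variables such that the law of $L_{ij}$ does not depend on $i$, and let $(L_1,\ldots,L_k)$ be a generic vector distributed as $(L_{i1},\ldots,L_{ik})$. The families $(X_i)$, $(T_i)$ and $(L_{ij})$ are independent of each other. For $\delta\ge 0$, $t\ge 0$ and $j=1,\ldots,k$ set $$\tilde Z_j(t)=e^{\delta t}\sum_{i=1}^{N_t}X_{ij}e^{-\delta(L_{ij}+T_i)}\mathbf 1_{[t<L_{ij}+T_i]},\qquad \tilde Z(t)=(\tilde Z_1(t),\ldots,\tilde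 Z_k(t)).$$ For $s\in\mathbb R^k$, $t\ge0$ and $r\ge 0$ define the ${\cal S}\times{\cal S}$ matrices $$\tilde\psi(s,t)=\Big[\mathbb E\big(e^{\langle s,\tilde Z(t)\rangle}\mathbf 1_{[X_{N_t}=y]}\,\big|\,X_0=x\big)\Big]_{(x,y)\in{\cal S}^2},$$ $$\tilde\pi(s,r)=\mathrm{diag}\Big[\mathbb E\Big(\exp\Big\{\sum_{j=1}^k s_jx_je^{-\delta(L_j-r)}\mathbf 1_{[L_j>r]}\Big\}\Big),\ x\in{\cal S}\Big],\qquad \tilde Q(s,r)=\tilde\pi(s,r)P',$$ where $'$ denotes the transpose. Products of matrices are ordered from left to right by increasing index, and an empty product is the identity. **Theorem.** Suppose that $\tau=1$ almost surely. 1. For all $s\in\mathbb R^k$ and $t\in\mathbb N=\{0,1,2,\ldots\}$, the expectations defining $\tilde\psi(s,t)$ are finite and $$\tilde\psi(s,t)=\Big[\prod_{m=0}^{t-1}\tilde Q(s,m)\Big]'=\prod_{m=1}^{t}\tilde Q(s,t-m)'.$$ 2. Suppose moreover that $\mathbb E(L_j)$ is finite for all $j=1,\ldots,k$. Then for every $s\in\mathbb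 R^k$ the limit $\prod_{m=0}^\infty\tilde Q(s,m):=\lim_{t\to\infty}\prod_{m=0}^{t}\tilde Q(s,m)$ exists. Moreover, for every $x\in{\cal S}$, given $X_0=x$, the pair $(\tilde Z(t),X_{N_t})$ converges in distribution, as $t\to\infty$ along the integers, to some pair $({\cal Z}_\infty,{\cal X}^x_\infty)$ with values in $\mathbb R^k\times{\cal S}$ (whose law may depend on $x$). The joint mgf of the limit is finite for every $s\in\mathbb R^k$ and is given by $$\Big[\mathbb E\big(e^{\langle s,{\cal Z}_\infty\rangle}\mathbf 1_{[{\cal X}^x_\infty=y]}\big)\Big]_{(x,y)\in{\cal S}^2}=\Big[\prod_{m=0}^\infty\tilde Q(s,m)\Big]'.$$ -/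

import Mathlib

open MeasureTheory ProbabilityTheory Filter Topology

namespace DiscountedQueue

/-- The state space `{0, …, K}^k` of the batch sizes. -/
abbrev State (k K : ℕ) : Type := Fin k → Fin (K + 1)

/-- Every state has period one: the only natural number dividing all the lengths `n ≥ 1` of the
possible returns to `x` is `1`. -/
def Aperiodic {S : Type*} [Fintype S] [DecidableEq S] (P : Matrix S S ℝ) : Prop :=
  ∀ x : S, ∀ d : ℕ, (∀ n : ℕ, 1 ≤ n → 0 < (P ^ n) x x → d ∣ n) → d = 1

/-- `(X_i)_{i ∈ ℕ}` is a stationary ergodic (irreducible and aperiodic) homogeneous Markov chain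
on the finite set `S` with transition matrix `P`. -/
structure IsStationaryErgodicChain {Ω : Type*} [MeasurableSpace Ω] (μ : Measure Ω)
    {S : Type*} [Fintype S] [DecidableEq S] [MeasurableSpace S]
    (P : Matrix S S ℝ) (X : ℕ → Ω → S) : Prop where
  measurable : ∀ i, Measurable (X i)
  stochastic : P ∈ Matrix.rowStochastic ℝ S
  irreducible : P.IsIrreducible
  aperiodic : Aperiodic P
  /-- the finite-dimensional distributions are those of a Markov chain with transitions `P` -/
  markov : ∀ (n : ℕ) (x : ℕ → S),
    μ.real {ω | ∀ i ≤ n, X i ω = x i} =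
      μ.real {ω | X 0 ω = x 0} * ∏ i ∈ Finset.range n, P (x i) (x (i + 1))
  /-- the initial distribution is invariant -/
  stationary : ∀ y : S, ∑ x, μ.real {ω | X 0 ω = x} * P x y = μ.real {ω | X 0 ω = y}

/-- The probabilistic model: arrival times `T_i`, batch sizes `X_i = (X_{i1}, …, X_{ik})` and
service times (delays) `L_{ij}`. The generic service times `(L_1, …, L_k)` are `(L_{01}, …, L_{0k})`,
which do not enter the queueing process itself. -/
structure IsModel {Ω : Type*} [MeasurableSpace Ω] (μ : Measure Ω) {k K : ℕ}
    (P : Matrix (State k K) (State k K) ℝ) (X : ℕ → Ω → State k K)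
    (L : ℕ → Fin k → Ω → ℝ) (T : ℕ → Ω → ℝ) : Prop where
  chain : IsStationaryErgodicChain μ P X
  measurable_T : ∀ i, Measurable (T i)
  T_zero : ∀ᵐ ω ∂μ, T 0 ω = 0
  T_mono : ∀ᵐ ω ∂μ, Monotone fun i => T i ω
  iIndepFun_increments : iIndepFun (fun i ω => T (i + 1) ω - T i ω) μ
  identDistrib_increments : ∀ i, IdentDistrib (fun ω => T (i + 1) ω - T i ω) (T 1) μ μ
  measurable_L : ∀ i j, Measurable (L i j)
  iIndepFun_L : iIndepFun (fun p : ℕ × Fin k => L p.1 p.2) μ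
  identDistrib_L : ∀ i j, IdentDistrib (L i j) (L 0 j) μ μ
  /-- the arrival times are independent of the service times … -/
  indepFun_T_L : IndepFun (fun ω i => T i ω) (fun ω i j => L i j ω) μ
  /-- … and the Markov chain is independent of both -/
  indepFun_X : IndepFun (fun ω i => X i ω) (fun ω => ((fun i => T i ω), fun i j => L i j ω)) μ

variable {Ω : Type*} {k K : ℕ}

/-- The number `N_t` of arrivals in `(0, t]`, i.e. of indices `i ≥ 1` with `T_i ≤ t`. -/
noncomputable def arrivals (T : ℕ → Ω → ℝ) (t : ℝ) (ω : Ω) : ℕ :=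
  {i : ℕ | 1 ≤ i ∧ T i ω ≤ t}.ncard

/-- `Z_j(t) = ∑_{i=1}^{N_t} X_{ij} e^{-δ (L_{ij} + T_i)} 1_{t < L_{ij} + T_i}`. -/
noncomputable def Z (δ : ℝ) (X : ℕ → Ω → State k K) (L : ℕ → Fin k → Ω → ℝ) (T : ℕ → Ω → ℝ)
    (t : ℝ) (ω : Ω) : Fin k → ℝ := fun j =>
  ∑ i ∈ Finset.Icc 1 (arrivals T t ω),
    ((X i ω j : ℕ) : ℝ) * Real.exp (-δ * (L i j ω + T i ω)) *
      (if t < L i j ω + T i ω then 1 else 0)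

/-- `Z̃(t) = e^{δ t} Z(t)`. -/
noncomputable def Ztilde (δ : ℝ) (X : ℕ → Ω → State k K) (L : ℕ → Fin k → Ω → ℝ)
    (T : ℕ → Ω → ℝ) (t : ℝ) (ω : Ω) : Fin k → ℝ := fun j =>
  Real.exp (δ * t) * Z δ X L T t ω j

/-- The state `X_{N_t}`. -/
noncomputable def stateAt (X : ℕ → Ω → State k K) (T : ℕ → Ω → ℝ) (t : ℝ) (ω : Ω) :
    State k K :=
  X (arrivals T t ω) ω

/-- The conditional probability `ℙ(· | X_0 = x)`. -/
noncomputable def condInit [MeasurableSpace Ω] (μ : Measure Ω) (X : ℕ → Ω → State k K)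
    (x : State k K) : Measure Ω :=
  ProbabilityTheory.cond μ {ω | X 0 ω = x}

/-- The joint mgf `ψ̃(s,t) = [𝔼(e^{⟨s, Z̃(t)⟩} 1_{X_{N_t} = y} | X_0 = x)]_{(x,y)}`. -/
noncomputable def psiTilde [MeasurableSpace Ω] (μ : Measure Ω) (δ : ℝ)
    (X : ℕ → Ω → State k K) (L : ℕ → Fin k → Ω → ℝ) (T : ℕ → Ω → ℝ)
    (s : Fin k → ℝ) (t : ℝ) : Matrix (State k K) (State k K) ℝ :=
  Matrix.of fun x y =>
    ∫ ω, Real.exp (∑ j, s j * Ztilde δ X L T t ω j) *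
      (if stateAt X T t ω = y then 1 else 0) ∂(condInit μ X x)

/-- `π̃(s,r) = diag[𝔼 exp(∑_j s_j x_j e^{-δ (L_j - r)} 1_{L_j > r}), x ∈ S]`, where `G` is the
generic vector `(L_1, …, L_k)`. -/
noncomputable def piTilde [MeasurableSpace Ω] (μ : Measure Ω) (K : ℕ) (δ : ℝ)
    (G : Fin k → Ω → ℝ) (s : Fin k → ℝ) (r : ℝ) : Matrix (State k K) (State k K) ℝ :=
  Matrix.diagonal fun x =>
    ∫ ω, Real.exp (∑ j, s j * ((x j : ℕ) : ℝ) * Real.exp (-δ * (G j ω - r)) *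
      (if r < G j ω then 1 else 0)) ∂μ

/-- `Q̃(s,r) = π̃(s,r) P'`. -/
noncomputable def Qtilde [MeasurableSpace Ω] (μ : Measure Ω) (δ : ℝ)
    (P : Matrix (State k K) (State k K) ℝ) (G : Fin k → Ω → ℝ) (s : Fin k → ℝ) (r : ℝ) :
    Matrix (State k K) (State k K) ℝ :=
  piTilde μ K δ G s r * P.transpose

/-- The ordered product `A_0 A_1 ⋯ A_{n-1}`, from left to right. -/
def orderedProd {S : Type*} [Fintype S] [DecidableEq S] (A : ℕ → Matrix S S ℝ) (n : ℕ) :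
    Matrix S S ℝ :=
  ((List.range n).map A).prod

end DiscountedQueue

/-! Since `τ = 1`, almost surely `T i = i`, and `Z̃(t)` is a fixed function `windowSum` of the
batches and services up to time `t`. Freeze the chain: independence of the services factorises the
mgf over customers, the one arriving at time `i` contributing the diagonal entry of `π̃(s, t - i)`
at `X i`. By the Markov property, averaging such a product along the chain gives a product of
matrices `P π̃`, the transposes of `Q̃` (`setIntegral_exp_windowSum`). Transposition reverses the
order, whence both forms of part 1.

In part 2 the convergence of the product is read off from convergence of the laws. Split time as `r
+ n`. For large `n` all of the first `r` customers have left with high probability, uniformly in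
`r`, because a finite mean makes the tails `ℙ(L_j > m)` summable; the queue is then a function of
the last `n` batches and services. The chain is primitive, so for large `r` the window `X r, …, X (r
+ n)` given `X 0 = x` is close in total variation to its stationary version, and the services are
shift invariant. Hence the conditional laws are Cauchy in total variation (`abs_measureReal_sub_le`)
and have a setwise limit `ρ`, which gives convergence in distribution.

Up to the factor `1 / ℙ(X_0 = x)`, the conditional mgf's are bounded in time by `exp(∑_j (e^{|s_j|
K} - 1) ∑_m ℙ(L_j > m))`. At `2s` this is a uniform second-moment bound for `e^{⟨s, ·⟩}`, so the
mgf's converge to that of `ρ`. By part 1 they are entries of transposed partial products, so the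
infinite product exists and has the claimed value. -/

namespace DiscountedQueue

/-! ### Primitive stochastic matrices and convergence of their powers. -/

section Matrix

variable {S : Type*} [Fintype S] [DecidableEq S] {P : Matrix S S ℝ}

theorem matrix_pow_add_apply_pos (hP : ∀ i j, 0 ≤ P i j) {x y z : S} {m n : ℕ}
    (h₁ : 0 < (P ^ m) x y) (h₂ : 0 < (P ^ n) y z) : 0 < (P ^ (m + n)) x z := by
  rw [pow_add, Matrix.mul_apply]
  exact Finset.sum_pos' (fun i _ => mul_nonneg (Matrix.pow_apply_nonneg hP m x i)
    (Matrix.pow_apply_nonneg hP n i z)) ⟨y, Finset.mem_univ y, mul_pos h₁ h₂⟩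

/-- The possible return times form an additive submonoid of `ℕ` whose gcd is 1 by aperiodicity, and
such a submonoid contains all large integers. -/
theorem Aperiodic.eventually_pow_self_pos (hP : ∀ i j, 0 ≤ P i j) (ha : Aperiodic P) (x : S) :
    ∃ N, ∀ n ≥ N, 0 < (P ^ n) x x := by
  let R : AddSubmonoid ℕ :=
    { carrier := {n | 0 < (P ^ n) x x}
      zero_mem' := by simp
      add_mem' := fun ha hb => matrix_pow_add_apply_pos hP ha hb }
  have hgcd : Nat.setGcd (R : Set ℕ) = 1 :=
    ha x _ fun n _ hn => Nat.setGcd_dvd_of_mem (s := (R : Set ℕ)) hn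
  obtain ⟨N, hN⟩ := Nat.exists_mem_closure_of_ge (R : Set ℕ)
  refine ⟨N, fun n hn => ?_⟩
  have := hN n hn (by simp [hgcd])
  rw [AddSubmonoid.closure_eq] at this
  exact this

theorem isPrimitive_of_isIrreducible_of_aperiodic (hi : P.IsIrreducible) (ha : Aperiodic P) :
    P.IsPrimitive := by
  have hP := hi.nonneg
  refine ⟨hP, ?_⟩
  choose N hN using fun x => ha.eventually_pow_self_pos hP x
  choose k _ hk using (Matrix.isIrreducible_iff_exists_pow_pos hP).1 hi
  -- One exponent for all pairs: loop at `x` for the surplus time, which is at least `N x`, then go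
  -- to `y` in `k x y` steps. The `+ 1` makes the exponent positive.
  refine ⟨(∑ x, N x) + (∑ x, ∑ y, k x y) + 1, by omega, fun x y => ?_⟩
  have h₁ : N x ≤ ∑ x, N x := Finset.single_le_sum (fun _ _ => Nat.zero_le _) (Finset.mem_univ x)
  have h₂ : k x y ≤ ∑ y, k x y :=
    Finset.single_le_sum (f := fun y => k x y) (fun _ _ => Nat.zero_le _) (Finset.mem_univ y)
  have h₃ : ∑ y, k x y ≤ ∑ x, ∑ y, k x y :=
    Finset.single_le_sum (f := fun x => ∑ y, k x y) (fun _ _ => Nat.zero_le _) (Finset.mem_univ x)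
  have h := matrix_pow_add_apply_pos hP
    (hN x ((∑ x, N x) + (∑ x, ∑ y, k x y) + 1 - k x y) (by omega)) (hk x y)
  rwa [Nat.sub_add_cancel (by omega)] at h

theorem invariant_pow {p : S → ℝ} (hp : ∀ y, ∑ x, p x * P x y = p y) (n : ℕ) (y : S) :
    ∑ x, p x * (P ^ n) x y = p y := by
  have h : Matrix.vecMul p P = p := funext hp
  have : Matrix.vecMul p (P ^ n) = p := by
    induction n with
    | zero => simp
    | succ n ih => rw [pow_succ, ← Matrix.vecMul_vecMul, ih, h]
  exact congrFun this y

theorem Matrix.IsPrimitive.invariant_pos (hP : P.IsPrimitive) {p : S → ℝ}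
    (hp0 : ∀ x, 0 ≤ p x) (hp1 : ∑ x, p x = 1) (hp : ∀ y, ∑ x, p x * P x y = p y) (y : S) :
    0 < p y := by
  obtain ⟨n, -, hn⟩ := hP.exists_pos_pow
  obtain ⟨x, hx⟩ : ∃ x, 0 < p x := by
    by_contra! h
    have := Finset.sum_nonpos fun x (_ : x ∈ Finset.univ) => h x
    linarith
  rw [← invariant_pow hp n y]
  exact Finset.sum_pos' (fun i _ => mul_nonneg (hp0 i) (hn i y).le)
    ⟨x, Finset.mem_univ x, mul_pos hx (hn x y)⟩

theorem tendsto_zero_of_antitone_of_contraction {d : ℕ → ℝ} (h0 : ∀ n, 0 ≤ d n)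
    (hd : Antitone d) {N : ℕ} {c : ℝ} (hc : c < 1) (h : ∀ n, d (n + N) ≤ c * d n) :
    Tendsto d atTop (𝓝 0) := by
  have hl := tendsto_atTop_ciInf hd ⟨0, by rintro _ ⟨n, rfl⟩; exact h0 n⟩
  set l := ⨅ n, d n
  have hl0 : 0 ≤ l := ge_of_tendsto' hl h0
  have hle : l ≤ c * l :=
    le_of_tendsto_of_tendsto' (hl.comp (tendsto_add_atTop_nat N)) (hl.const_mul c) h
  have : l = 0 := by nlinarith
  rwa [this] at hl

omit [DecidableEq S] in
-- Used below with `c = 1` for monotonicity of the `ℓ¹` distance and with `c = 1 - ε` for its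
-- contraction.
theorem sum_abs_vecMul_le {A : Matrix S S ℝ} {c : ℝ} (hA : ∀ x y, 0 ≤ A x y)
    (hc : ∀ x, ∑ y, A x y = c) (v : S → ℝ) :
    ∑ y, |∑ z, v z * A z y| ≤ c * ∑ z, |v z| := by
  calc ∑ y, |∑ z, v z * A z y| ≤ ∑ y, ∑ z, |v z| * A z y := by
        gcongr with y
        refine (Finset.abs_sum_le_sum_abs _ _).trans (Finset.sum_le_sum fun z _ => ?_)
        rw [abs_mul, abs_of_nonneg (hA z y)]
    _ = c * ∑ z, |v z| := by
        rw [Finset.sum_comm, Finset.mul_sum]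
        refine Finset.sum_congr rfl fun z _ => ?_
        rw [← Finset.mul_sum, hc, mul_comm]

/-- The rows of the powers of a primitive stochastic matrix converge to its invariant
distribution. -/
theorem tendsto_pow_apply_of_isPrimitive (hS : P ∈ Matrix.rowStochastic ℝ S)
    (hP : P.IsPrimitive) {p : S → ℝ} (hp0 : ∀ x, 0 ≤ p x) (hp1 : ∑ x, p x = 1)
    (hp : ∀ y, ∑ x, p x * P x y = p y) (x y : S) :
    Tendsto (fun n => (P ^ n) x y) atTop (𝓝 (p y)) := by
  obtain ⟨N, -, hN⟩ := hP.exists_pos_pow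
  have hpow (n : ℕ) : P ^ n ∈ Matrix.rowStochastic ℝ S := pow_mem hS n
  have hp_le (y : S) : p y ≤ 1 := by
    rw [← hp1]; exact Finset.single_le_sum (fun i _ => hp0 i) (Finset.mem_univ y)
  obtain ⟨ε, hε, hεN⟩ : ∃ ε > 0, ∀ i j, ε ≤ (P ^ N) i j := by
    have : Nonempty (S × S) := ⟨(x, y)⟩
    obtain ⟨q, hq⟩ := Finite.exists_min fun q : S × S => (P ^ N) q.1 q.2
    exact ⟨_, hN q.1 q.2, fun i j => hq (i, j)⟩
  have hv (n : ℕ) : ∑ z, ((P ^ n) x z - p z) = 0 := by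
    rw [Finset.sum_sub_distrib, Matrix.sum_row_of_mem_rowStochastic (hpow n), hp1, sub_self]
  have hstep (n m : ℕ) (y : S) :
      (P ^ (n + m)) x y - p y = ∑ z, ((P ^ n) x z - p z) * (P ^ m) z y := by
    simp only [sub_mul, Finset.sum_sub_distrib]
    rw [invariant_pow hp, pow_add, Matrix.mul_apply]
  set d : ℕ → ℝ := fun n => ∑ y, |(P ^ n) x y - p y| with hd
  have hd0 (n : ℕ) : 0 ≤ d n := Finset.sum_nonneg fun _ _ => abs_nonneg _
  have hlim : Tendsto d atTop (𝓝 0) := by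
    refine tendsto_zero_of_antitone_of_contraction hd0 ?_ (N := N) (c := 1 - ε)
      (by linarith) fun n => ?_
    · refine antitone_nat_of_succ_le fun n => ?_
      simp only [hd, hstep n 1]
      refine (sum_abs_vecMul_le (c := 1) (fun x y => Matrix.nonneg_of_mem_rowStochastic (hpow 1))
        (Matrix.sum_row_of_mem_rowStochastic (hpow 1)) _).trans_eq (one_mul _)
    -- Doeblin's argument: a row difference has total mass zero, so subtracting `ε * p y` from
    -- column `y` changes nothing. What is left of `P ^ N` is still nonnegative, as `p y ≤ 1`, and
    -- has row sums `1 - ε`.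
    · have h (y : S) : (P ^ (n + N)) x y - p y =
          ∑ z, ((P ^ n) x z - p z) * ((P ^ N) z y - ε * p y) := by
        simp only [mul_sub, Finset.sum_sub_distrib, ← Finset.sum_mul, hv, ← hstep]
        ring
      simp only [hd, h]
      refine sum_abs_vecMul_le (A := fun z y => (P ^ N) z y - ε * p y) (c := 1 - ε)
        (fun z y => ?_) (fun z => ?_) _
      · have := hεN z y
        have := hp_le y
        nlinarith
      · rw [Finset.sum_sub_distrib, Matrix.sum_row_of_mem_rowStochastic (hpow N),
          ← Finset.mul_sum, hp1, mul_one]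
  rw [tendsto_iff_norm_sub_tendsto_zero]
  refine squeeze_zero (fun _ => norm_nonneg _) (fun n => ?_) hlim
  exact Finset.single_le_sum (f := fun y => |(P ^ n) x y - p y|) (fun _ _ => abs_nonneg _)
    (Finset.mem_univ y)

end Matrix


/-! ### Setwise limits of probability measures and convergence of moments. -/

section LimitMeasure

variable {E : Type*} [MeasurableSpace E]

/-- A sequence of probability measures which is Cauchy in total variation converges on every
measurable set to a probability measure. -/
theorem exists_isProbabilityMeasure_tendsto_real (ν : ℕ → Measure E)
    [∀ n, IsProbabilityMeasure (ν n)]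
    (h : ∀ ε > 0, ∃ N, ∀ m ≥ N, ∀ n ≥ N, ∀ A, MeasurableSet A →
      |(ν m).real A - (ν n).real A| ≤ ε) :
    ∃ ρ : Measure E, IsProbabilityMeasure ρ ∧
      ∀ A, MeasurableSet A → Tendsto (fun n => (ν n).real A) atTop (𝓝 (ρ.real A)) := by
  have hlim (A : Set E) : ∃ a, MeasurableSet A → Tendsto (fun n => (ν n).real A) atTop (𝓝 a) := by
    by_cases hA : MeasurableSet A
    · have : CauchySeq fun n => (ν n).real A := by
        rw [Metric.cauchySeq_iff]
        intro ε hε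
        obtain ⟨N, hN⟩ := h (ε / 2) (by positivity)
        refine ⟨N, fun m hm n hn => ?_⟩
        rw [Real.dist_eq]
        linarith [hN m hm n hn A hA]
      obtain ⟨a, ha⟩ := cauchySeq_tendsto_of_complete this
      exact ⟨a, fun _ => ha⟩
    · exact ⟨0, fun h => absurd h hA⟩
  choose g hg using hlim
  -- Letting one index of the Cauchy bound tend to infinity makes the approximation of `g` uniform
  -- over measurable sets; this is what transfers countable additivity to `g`.
  have hunif : ∀ ε > 0, ∃ N, ∀ A, MeasurableSet A → |(ν N).real A - g A| ≤ ε := by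
    intro ε hε
    obtain ⟨N, hN⟩ := h ε hε
    refine ⟨N, fun A hA => ?_⟩
    refine le_of_tendsto (tendsto_const_nhds.sub (hg A hA)).abs ?_
    filter_upwards [eventually_ge_atTop N] with n hn using hN N le_rfl n hn A hA
  have hg0 (A : Set E) (hA : MeasurableSet A) : 0 ≤ g A :=
    ge_of_tendsto' (hg A hA) fun _ => measureReal_nonneg
  have hempty : g ∅ = 0 := tendsto_nhds_unique (hg ∅ .empty) (by simp)
  have huniv : g Set.univ = 1 := tendsto_nhds_unique (hg _ .univ) (by simp)
  have hsum (f : ℕ → Set E) (hf : ∀ i, MeasurableSet (f i))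
      (hd : Pairwise (Function.onFun Disjoint f)) : HasSum (fun i => g (f i)) (g (⋃ i, f i)) := by
    rw [hasSum_iff_tendsto_nat_of_nonneg fun i => hg0 _ (hf i)]
    have hB (n : ℕ) : MeasurableSet (⋃ i ∈ Finset.range n, f i) :=
      Finset.measurableSet_biUnion _ fun i _ => hf i
    have hadd (n : ℕ) : ∑ i ∈ Finset.range n, g (f i) = g (⋃ i ∈ Finset.range n, f i) := by
      refine tendsto_nhds_unique (tendsto_finsetSum _ fun i _ => hg (f i) (hf i))
        ((hg _ (hB n)).congr fun m => ?_)
      exact measureReal_biUnion_finset (fun i _ j _ hij => hd hij) fun i _ => hf i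
    simp only [hadd]
    have hcont (m : ℕ) : Tendsto (fun n => (ν m).real (⋃ i ∈ Finset.range n, f i)) atTop
        (𝓝 ((ν m).real (⋃ i, f i))) := by
      have hmono : Monotone fun n => ⋃ i ∈ Finset.range n, f i := fun a b hab =>
        Set.biUnion_subset_biUnion_left fun i hi =>
          Finset.mem_coe.2 (Finset.range_mono hab (Finset.mem_coe.1 hi))
      have hU : ⋃ n, ⋃ i ∈ Finset.range n, f i = ⋃ i, f i := by
        ext x
        simp only [Set.mem_iUnion, Finset.mem_range, exists_prop]
        exact ⟨fun ⟨_, i, _, hi⟩ => ⟨i, hi⟩, fun ⟨i, hi⟩ => ⟨i + 1, i, i.lt_succ_self, hi⟩⟩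
      have := tendsto_measure_iUnion_atTop (μ := ν m) hmono
      rw [hU] at this
      exact (ENNReal.tendsto_toReal (measure_ne_top _ _)).comp this
    rw [Metric.tendsto_atTop]
    intro ε hε
    obtain ⟨N, hN⟩ := hunif (ε / 4) (by positivity)
    obtain ⟨M, hM⟩ := Metric.tendsto_atTop.1 (hcont N) (ε / 4) (by positivity)
    refine ⟨M, fun n hn => ?_⟩
    have h₁ := abs_le.1 (hN _ (hB n))
    have h₂ := abs_le.1 (hN _ (MeasurableSet.iUnion hf))
    have h₃ := hM n hn
    rw [Real.dist_eq, abs_lt] at h₃ ⊢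
    constructor <;> linarith
  let ρ : Measure E := Measure.ofMeasurable (fun A _ => ENNReal.ofReal (g A)) (by simp [hempty])
    fun f hf hd => by
      rw [← (hsum f hf hd).tsum_eq, ENNReal.ofReal_tsum_of_nonneg (fun i => hg0 _ (hf i))
        (hsum f hf hd).summable]
  have hρ (A : Set E) (hA : MeasurableSet A) : ρ A = ENNReal.ofReal (g A) :=
    Measure.ofMeasurable_apply A hA
  refine ⟨ρ, ⟨by rw [hρ _ .univ, huniv, ENNReal.ofReal_one]⟩, fun A hA => ?_⟩
  rw [measureReal_def, hρ A hA, ENNReal.toReal_ofReal (hg0 A hA)]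
  exact hg A hA

variable {ν : ℕ → Measure E} [∀ n, IsProbabilityMeasure (ν n)] {ρ : Measure E}
  [IsProbabilityMeasure ρ]

theorem tendsto_measure_of_tendsto_real {A : Set E}
    (h : Tendsto (fun n => (ν n).real A) atTop (𝓝 (ρ.real A))) :
    Tendsto (fun n => ν n A) atTop (𝓝 (ρ A)) :=
  (ENNReal.tendsto_toReal_iff (fun _ => measure_ne_top _ _) (measure_ne_top _ _)).1 h

theorem sub_min_le_sq_div {a M : ℝ} (hM : 0 < M) : a - min a M ≤ a ^ 2 / M := by
  rw [le_div_iff₀ hM]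
  rcases le_total a M with h | h
  · simp [h, sq_nonneg]
  · rw [min_eq_right h]
    nlinarith [sq_nonneg (a - M)]

/-- The truncation error depends on the measure only through the second-moment bound, so it is
uniform along a sequence and its limit. -/
theorem abs_integral_sub_integral_min_le {κ : Measure E} [IsProbabilityMeasure κ] {f : E → ℝ}
    (hfi : Integrable f κ) (hf2 : Integrable (fun x => f x ^ 2) κ) {C M : ℝ}
    (hC : ∫ x, f x ^ 2 ∂κ ≤ C) (hM : 0 < M) :
    |∫ x, f x ∂κ - ∫ x, min (f x) M ∂κ| ≤ C / M := by
  have hmin : Integrable (fun x => min (f x) M) κ := hfi.inf (integrable_const M)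
  rw [← integral_sub hfi hmin, abs_of_nonneg (integral_nonneg fun x => sub_nonneg.2 (min_le_left _ _))]
  calc ∫ x, (f x - min (f x) M) ∂κ ≤ ∫ x, f x ^ 2 / M ∂κ :=
        integral_mono (hfi.sub hmin) (hf2.div_const M) fun x => sub_min_le_sq_div hM
    _ ≤ C / M := by rw [integral_div]; gcongr

variable [TopologicalSpace E] [OpensMeasurableSpace E]

/-- Convergence on open sets already suffices, by the portmanteau theorem. -/
theorem tendsto_probabilityMeasure_of_tendsto_real
    (h : ∀ A, MeasurableSet A → Tendsto (fun n => (ν n).real A) atTop (𝓝 (ρ.real A))) :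
    Tendsto (β := ProbabilityMeasure E) (fun n => ⟨ν n, inferInstance⟩) atTop
      (𝓝 ⟨ρ, inferInstance⟩) :=
  tendsto_of_forall_isOpen_le_liminf_nat' fun G hG =>
    (tendsto_measure_of_tendsto_real (h G hG.measurableSet)).liminf_eq.ge

/-- Setwise convergence together with a uniform bound on second moments gives convergence of the
first moments. -/
theorem tendsto_integral_of_integral_sq_le
    (h : ∀ A, MeasurableSet A → Tendsto (fun n => (ν n).real A) atTop (𝓝 (ρ.real A)))
    {f : E → ℝ} (hf : Continuous f) (hf0 : 0 ≤ f) (hf2 : ∀ n, Integrable (fun x => f x ^ 2) (ν n))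
    {C : ℝ} (hC : ∀ n, ∫ x, f x ^ 2 ∂(ν n) ≤ C) :
    Integrable f ρ ∧ Tendsto (fun n => ∫ x, f x ∂(ν n)) atTop (𝓝 (∫ x, f x ∂ρ)) := by
  have hsq {κ : Measure E} [IsProbabilityMeasure κ] (h2 : Integrable (fun x => f x ^ 2) κ) :
      Integrable f κ :=
    ((memLp_two_iff_integrable_sq hf.measurable.aestronglyMeasurable).2 h2).integrable one_le_two
  have hfsq : Continuous fun x => f x ^ 2 := hf.pow 2
  -- Fatou's lemma along the sequence of measures: the limit inherits the second-moment bound.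
  have hle : ∫⁻ x, ENNReal.ofReal (f x ^ 2) ∂ρ ≤ ENNReal.ofReal C := by
    refine (lintegral_le_liminf_lintegral_of_forall_isOpen_measure_le_liminf_measure hfsq
      (fun x => sq_nonneg (f x)) fun G hG =>
        (tendsto_measure_of_tendsto_real (h G hG.measurableSet)).liminf_eq.ge).trans ?_
    refine liminf_le_of_le (by isBoundedDefault) fun b hb => ?_
    obtain ⟨n, hn⟩ := hb.exists
    refine hn.trans ?_
    rw [← ofReal_integral_eq_lintegral_ofReal (hf2 n) (.of_forall fun x => sq_nonneg (f x))]
    exact ENNReal.ofReal_le_ofReal (hC n)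
  have hρ2 : Integrable (fun x => f x ^ 2) ρ :=
    (lintegral_ofReal_ne_top_iff_integrable hfsq.measurable.aestronglyMeasurable
      (.of_forall fun x => sq_nonneg (f x))).1 (hle.trans_lt ENNReal.ofReal_lt_top).ne
  have hC0 : 0 ≤ C := (integral_nonneg fun x => sq_nonneg (f x)).trans (hC 0)
  have hρC : ∫ x, f x ^ 2 ∂ρ ≤ C := by
    rw [integral_eq_lintegral_of_nonneg_ae (.of_forall fun x => sq_nonneg (f x))
      hfsq.measurable.aestronglyMeasurable]
    exact ENNReal.toReal_le_of_le_ofReal hC0 hle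
  refine ⟨hsq hρ2, ?_⟩
  rw [Metric.tendsto_atTop]
  intro ε hε
  obtain ⟨M, hM, hMε⟩ : ∃ M > 0, C / M ≤ ε / 4 := by
    -- `C + 1` rather than `C` keeps the truncation level positive when `C = 0`.
    refine ⟨4 * (C + 1) / ε, by positivity, ?_⟩
    rw [div_le_iff₀ (by positivity)]
    field_simp
    linarith
  let b : BoundedContinuousFunction E ℝ :=
    BoundedContinuousFunction.ofNormedAddCommGroup (fun x => min (f x) M)
      (hf.min continuous_const) M fun x => by
        rw [Real.norm_of_nonneg (le_min (hf0 x) hM.le)]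
        exact min_le_right _ _
  have hb : Tendsto (fun n => ∫ x, min (f x) M ∂(ν n)) atTop (𝓝 (∫ x, min (f x) M ∂ρ)) :=
    ProbabilityMeasure.tendsto_iff_forall_integral_tendsto.1
      (tendsto_probabilityMeasure_of_tendsto_real h) b
  obtain ⟨N, hN⟩ := Metric.tendsto_atTop.1 hb (ε / 4) (by positivity)
  refine ⟨N, fun n hn => ?_⟩
  have h₁ := abs_le.1 (abs_integral_sub_integral_min_le (hsq (hf2 n)) (hf2 n) (hC n) hM)
  have h₂ := abs_le.1 (abs_integral_sub_integral_min_le (hsq hρ2) hρ2 hρC hM)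
  have h₃ := hN n hn
  rw [Real.dist_eq, abs_lt] at h₃ ⊢
  constructor <;> linarith

end LimitMeasure


/-! ### Path probabilities and the Markov property. -/

section Chain

variable {Ω : Type*} [MeasurableSpace Ω] {μ : Measure Ω}

theorem measureReal_eq_sum_and_eq [IsFiniteMeasure μ] {β : Type*} [Fintype β] [MeasurableSpace β]
    [MeasurableSingletonClass β] {Y : Ω → β} (hY : Measurable Y) {p : Ω → Prop}
    (hp : MeasurableSet {ω | p ω}) :
    μ.real {ω | p ω} = ∑ b, μ.real {ω | p ω ∧ Y ω = b} := by
  rw [← measureReal_biUnion_finset]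
  · congr 1
    ext ω
    simp
  · intro a _ b _ hab
    refine Set.disjoint_left.2 fun ω h₁ h₂ => hab (h₁.2.symm.trans h₂.2)
  · exact fun b _ => hp.inter (hY (measurableSet_singleton b))

theorem setIntegral_comp_eq_sum [IsFiniteMeasure μ] {β : Type*} [Fintype β] [MeasurableSpace β]
    [MeasurableSingletonClass β] {Y : Ω → β} (hY : Measurable Y) {p : Ω → Prop}
    (F : β → ℝ) :
    ∫ ω in {ω | p ω}, F (Y ω) ∂μ = ∑ b, μ.real {ω | p ω ∧ Y ω = b} * F b := by
  have hF : Measurable F := measurable_of_finite F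
  rw [← integral_map (f := F) hY.aemeasurable hF.aestronglyMeasurable,
    integral_fintype .of_finite]
  refine Finset.sum_congr rfl fun b _ => ?_
  rw [smul_eq_mul, map_measureReal_apply hY (measurableSet_singleton b),
    measureReal_restrict_apply (hY (measurableSet_singleton b)), Set.inter_comm]
  rfl

variable {S : Type*} [Fintype S] [DecidableEq S] [MeasurableSpace S] [MeasurableSingletonClass S]
  {P : Matrix S S ℝ} {X : ℕ → Ω → S}

/-- The path `b 0, …, b n, y, y, …`. -/
def extendPath {n : ℕ} (b : Fin (n + 1) → S) (y : S) (i : ℕ) : S :=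
  if h : i < n + 1 then b ⟨i, h⟩ else y

omit [Fintype S] [DecidableEq S] [MeasurableSpace S] [MeasurableSingletonClass S] in
theorem extendPath_of_le {n : ℕ} (b : Fin (n + 1) → S) (y : S) {i : ℕ} (h : i ≤ n) :
    extendPath b y i = b ⟨i, Nat.lt_succ_of_le h⟩ :=
  dif_pos _

omit [Fintype S] [DecidableEq S] [MeasurableSpace S] [MeasurableSingletonClass S] in
theorem extendPath_succ {n : ℕ} (b : Fin (n + 1) → S) (y : S) :
    extendPath b y (n + 1) = y :=
  dif_neg (lt_irrefl _)

omit [Fintype S] [DecidableEq S] [MeasurableSpace S] [MeasurableSingletonClass S] in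
theorem forall_le_eq_extendPath_iff {n : ℕ} (b : Fin (n + 1) → S) (y : S) (u : ℕ → S) :
    (∀ i ≤ n, u i = extendPath b y i) ↔ (fun i : Fin (n + 1) => u i) = b := by
  rw [funext_iff]
  constructor
  · intro h i
    rw [h i (Nat.le_of_lt_succ i.2), extendPath_of_le b y (Nat.le_of_lt_succ i.2)]
  · intro h i hi
    rw [extendPath_of_le b y hi]
    exact h ⟨i, Nat.lt_succ_of_le hi⟩

namespace IsStationaryErgodicChain

omit [MeasurableSingletonClass S] in
theorem isPrimitive (hX : IsStationaryErgodicChain μ P X) : P.IsPrimitive :=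
  isPrimitive_of_isIrreducible_of_aperiodic hX.irreducible hX.aperiodic

theorem measurableSet_eq (hX : IsStationaryErgodicChain μ P X) (n : ℕ) (x : S) :
    MeasurableSet {ω | X n ω = x} :=
  hX.measurable n (measurableSet_singleton x)

variable [IsProbabilityMeasure μ]

theorem sum_init (hX : IsStationaryErgodicChain μ P X) : ∑ x, μ.real {ω | X 0 ω = x} = 1 := by
  have := measureReal_eq_sum_and_eq (μ := μ) (hX.measurable 0) (p := fun _ => True) (by simp)
  simpa using this.symm

/-- Makes conditioning on `X 0 = x` legitimate for every state, and allows relative errors with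
respect to the stationary law. -/
theorem init_pos (hX : IsStationaryErgodicChain μ P X) (x : S) : 0 < μ.real {ω | X 0 ω = x} :=
  Matrix.IsPrimitive.invariant_pos hX.isPrimitive (p := fun x => μ.real {ω | X 0 ω = x})
    (fun _ => measureReal_nonneg) hX.sum_init hX.stationary x

/-- Induction on `r`: sum over the state at time `r` and absorb it into the window, which grows by
one; hence `n` and `w` are generalised. -/
theorem measureReal_path (hX : IsStationaryErgodicChain μ P X) (x : S) (r n : ℕ) (w : ℕ → S) :
    μ.real {ω | X 0 ω = x ∧ ∀ i ≤ n, X (r + i) ω = w i} =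
      μ.real {ω | X 0 ω = x} * (P ^ r) x (w 0) * ∏ i ∈ Finset.range n, P (w i) (w (i + 1)) := by
  induction r generalizing n w with
  | zero =>
    rcases eq_or_ne x (w 0) with rfl | h
    · rw [pow_zero, Matrix.one_apply_eq, mul_one, ← hX.markov n w]
      congr 1
      ext ω
      simp only [Set.mem_ofPred_eq, zero_add, and_iff_right_iff_imp]
      exact fun h => h 0 (Nat.zero_le _)
    · rw [pow_zero, Matrix.one_apply_ne h, mul_zero, zero_mul]
      convert measureReal_empty (μ := μ)
      refine Set.eq_empty_of_forall_notMem fun ω hω => h ?_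
      rw [← hω.1, ← hω.2 0 (Nat.zero_le _)]
  | succ r ih =>
    have hmeas : MeasurableSet {ω | X 0 ω = x ∧ ∀ i ≤ n, X (r + 1 + i) ω = w i} := by
      have h := MeasurableSet.iInter fun i => MeasurableSet.iInter fun _ : i ≤ n =>
        hX.measurableSet_eq (r + 1 + i) (w i)
      convert (hX.measurableSet_eq 0 x).inter h
      ext ω
      simp
    rw [measureReal_eq_sum_and_eq (hX.measurable r) hmeas, pow_succ, Matrix.mul_apply,
      Finset.mul_sum, Finset.sum_mul]
    refine Finset.sum_congr rfl fun z _ => ?_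
    let w' : ℕ → S := fun i => Nat.casesOn i z w
    have hset : {ω | (X 0 ω = x ∧ ∀ i ≤ n, X (r + 1 + i) ω = w i) ∧ X r ω = z} =
        {ω | X 0 ω = x ∧ ∀ i ≤ n + 1, X (r + i) ω = w' i} := by
      ext ω
      simp only [Set.mem_ofPred_eq, and_assoc]
      refine and_congr_right fun _ => ⟨fun ⟨h₁, h₂⟩ i hi => ?_, fun h => ⟨fun i hi => ?_, ?_⟩⟩
      · cases i with
        | zero => exact h₂
        | succ i =>
          rw [← add_assoc, add_right_comm]
          exact h₁ i (by omega)
      · rw [add_right_comm]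
        exact h (i + 1) (by omega)
      · exact h 0 (by omega)
    rw [hset, ih, Finset.prod_range_succ']
    change _ * (P ^ r) x z * (_ * P z (w 0)) = _
    ring

omit [MeasurableSingletonClass S] [IsProbabilityMeasure μ] in
-- If `b` ends at `z`, both events are single paths and their probabilities differ by one
-- transition; otherwise both are empty.
theorem measureReal_and_next (hX : IsStationaryErgodicChain μ P X) (t : ℕ) (z y : S)
    (b : Fin (t + 1) → S) :
    μ.real {ω | (X t ω = z ∧ X (t + 1) ω = y) ∧ (fun i : Fin (t + 1) => X i ω) = b} =
      μ.real {ω | X t ω = z ∧ (fun i : Fin (t + 1) => X i ω) = b} * P z y := by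
  by_cases h : b (Fin.last t) = z
  · subst h
    have h₁ : {ω | (X t ω = b (Fin.last t) ∧ X (t + 1) ω = y) ∧
        (fun i : Fin (t + 1) => X i ω) = b} = {ω | ∀ i ≤ t + 1, X i ω = extendPath b y i} := by
      ext ω
      simp only [Set.mem_ofPred_eq, ← forall_le_eq_extendPath_iff b y fun i => X i ω]
      refine ⟨fun ⟨⟨_, h₂⟩, h₃⟩ i hi => ?_, fun h => ⟨⟨?_, ?_⟩, fun i hi => h i (by omega)⟩⟩
      · rcases Nat.le_succ_iff.1 hi with hi | rfl
        · exact h₃ i hi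
        · rw [h₂, extendPath_succ]
      · rw [h t (by omega), extendPath_of_le b y le_rfl]; rfl
      · rw [h (t + 1) le_rfl, extendPath_succ]
    have h₂ : {ω | X t ω = b (Fin.last t) ∧ (fun i : Fin (t + 1) => X i ω) = b} =
        {ω | ∀ i ≤ t, X i ω = extendPath b y i} := by
      ext ω
      simp only [Set.mem_ofPred_eq, forall_le_eq_extendPath_iff b y fun i => X i ω]
      exact ⟨fun h => h.2, fun h => ⟨congrFun h (Fin.last t), h⟩⟩
    rw [h₁, h₂, hX.markov, hX.markov, Finset.prod_range_succ, extendPath_succ,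
      extendPath_of_le b y le_rfl, mul_assoc]
    rfl
  · have h₁ : {ω | (X t ω = z ∧ X (t + 1) ω = y) ∧ (fun i : Fin (t + 1) => X i ω) = b} = ∅ :=
      Set.eq_empty_of_forall_notMem fun ω hω => h (by rw [← hω.2, ← hω.1.1]; rfl)
    have h₂ : {ω | X t ω = z ∧ (fun i : Fin (t + 1) => X i ω) = b} = ∅ :=
      Set.eq_empty_of_forall_notMem fun ω hω => h (by rw [← hω.2, ← hω.1]; rfl)
    rw [h₁, h₂, measureReal_empty, zero_mul]

/-- The Markov property at time `t`, tested on functions of the past. -/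
theorem setIntegral_next (hX : IsStationaryErgodicChain μ P X) (t : ℕ) (y : S)
    (F : (Fin (t + 1) → S) → ℝ) :
    ∫ ω in {ω | X (t + 1) ω = y}, F (fun i => X i ω) ∂μ =
      ∑ z, (∫ ω in {ω | X t ω = z}, F (fun i => X i ω) ∂μ) * P z y := by
  have hY : Measurable fun ω => fun i : Fin (t + 1) => X i ω :=
    measurable_pi_iff.2 fun i => hX.measurable i
  simp only [setIntegral_comp_eq_sum hY F, Finset.sum_mul]
  rw [Finset.sum_comm]
  refine Finset.sum_congr rfl fun b _ => ?_
  rw [measureReal_eq_sum_and_eq (hX.measurable t)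
    (p := fun ω => X (t + 1) ω = y ∧ (fun i : Fin (t + 1) => X i ω) = b) ((hX.measurableSet_eq (t + 1) y).inter (hY (measurableSet_singleton b))), Finset.sum_mul]
  refine Finset.sum_congr rfl fun z _ => ?_
  rw [mul_right_comm, ← hX.measureReal_and_next]
  congr 3
  ext ω
  tauto

/-- Induction on `t`: on `X (t + 1) = y` the last factor is the constant `c t y`, and the Markov
property supplies `P`, so one time step is right multiplication by `P * diagonal (c t)`. -/
theorem setIntegral_prod (hX : IsStationaryErgodicChain μ P X) (c : ℕ → S → ℝ) (x y : S)
    (t : ℕ) :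
    ∫ ω in {ω | X t ω = y}, (if X 0 ω = x then 1 else 0) *
        ∏ i ∈ Finset.range t, c i (X (i + 1) ω) ∂μ =
      μ.real {ω | X 0 ω = x} * orderedProd (fun i => P * Matrix.diagonal (c i)) t x y := by
  induction t generalizing y with
  | zero =>
    have := setIntegral_comp_eq_sum (μ := μ) (hX.measurable 0) (p := fun ω => X 0 ω = y)
      fun b => if b = x then (1 : ℝ) else 0
    simp only [Finset.range_zero, Finset.prod_empty, mul_one, this, mul_ite, mul_zero,
      Finset.sum_ite_eq', Finset.mem_univ, if_true, orderedProd, List.range_zero, List.map_nil,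
      List.prod_nil, Matrix.one_apply]
    split_ifs with h
    · subst h
      simp
    · convert measureReal_empty (μ := μ)
      exact Set.eq_empty_of_forall_notMem fun ω hω => h (hω.2.symm.trans hω.1)
  | succ t ih =>
    have h₁ : ∫ ω in {ω | X (t + 1) ω = y}, (if X 0 ω = x then 1 else 0) *
        ∏ i ∈ Finset.range (t + 1), c i (X (i + 1) ω) ∂μ =
        ∫ ω in {ω | X (t + 1) ω = y}, ((if X 0 ω = x then 1 else 0) *
        ∏ i ∈ Finset.range t, c i (X (i + 1) ω)) * c t y ∂μ := by
      refine setIntegral_congr_fun (hX.measurableSet_eq (t + 1) y) fun ω hω => ?_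
      simp only [Set.mem_ofPred_eq] at hω
      simp only [Finset.prod_range_succ, hω, mul_assoc]
    have h₄ (ω : Ω) : ∏ i : Fin t, c i (X (i + 1) ω) =
        ∏ i ∈ Finset.range t, c i (X (i + 1) ω) :=
      (Finset.prod_range fun i => c i (X (i + 1) ω)).symm
    have h₂ : ∫ ω in {ω | X (t + 1) ω = y}, (if X 0 ω = x then 1 else 0) *
        ∏ i ∈ Finset.range t, c i (X (i + 1) ω) ∂μ =
        ∑ z, (∫ ω in {ω | X t ω = z}, (if X 0 ω = x then 1 else 0) *
          ∏ i ∈ Finset.range t, c i (X (i + 1) ω) ∂μ) * P z y := by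
      simp only [← h₄]
      exact hX.setIntegral_next t y fun b =>
        (if b 0 = x then 1 else 0) * ∏ i : Fin t, c i (b i.succ)
    rw [h₁, integral_mul_const, h₂]
    simp only [ih]
    have h₃ : orderedProd (fun i => P * Matrix.diagonal (c i)) (t + 1) =
        orderedProd (fun i => P * Matrix.diagonal (c i)) t * (P * Matrix.diagonal (c t)) := by
      simp [orderedProd, List.range_succ]
    rw [h₃, ← Matrix.mul_assoc, Matrix.mul_diagonal, Matrix.mul_apply, ← mul_assoc, Finset.mul_sum]
    simp only [mul_assoc]

theorem tendsto_pow_apply (hX : IsStationaryErgodicChain μ P X) (x y : S) :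
    Tendsto (fun n => (P ^ n) x y) atTop (𝓝 (μ.real {ω | X 0 ω = y})) :=
  tendsto_pow_apply_of_isPrimitive hX.stochastic hX.isPrimitive
    (p := fun y => μ.real {ω | X 0 ω = y}) (fun _ => measureReal_nonneg) hX.sum_init
    hX.stationary x y

/-- The error is relative, so that it sums to `η` against stationary path probabilities. -/
theorem eventually_abs_pow_sub_le (hX : IsStationaryErgodicChain μ P X) (x : S) {η : ℝ}
    (hη : 0 < η) : ∀ᶠ r in atTop, ∀ z,
      |(P ^ r) x z - μ.real {ω | X 0 ω = z}| ≤ η * μ.real {ω | X 0 ω = z} := by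
  refine eventually_all.2 fun z => ?_
  filter_upwards [Metric.tendsto_nhds.1 (hX.tendsto_pow_apply x z) _
    (mul_pos hη (hX.init_pos z))] with r hr using hr.le

/-- Conditionally on `X 0`, the law of a window of the chain is close in total variation to its
stationary law. -/
theorem abs_setIntegral_window_sub_le (hX : IsStationaryErgodicChain μ P X) (x : S) {η : ℝ}
    {r : ℕ} (hr : ∀ z, |(P ^ r) x z - μ.real {ω | X 0 ω = z}| ≤ η * μ.real {ω | X 0 ω = z})
    {n : ℕ} {Φ : (Fin (n + 1) → S) → ℝ} (hΦ : ∀ b, |Φ b| ≤ 1) :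
    |∫ ω in {ω | X 0 ω = x}, Φ (fun i => X (r + i) ω) ∂μ -
        μ.real {ω | X 0 ω = x} * ∫ ω, Φ (fun i => X i ω) ∂μ| ≤ μ.real {ω | X 0 ω = x} * η := by
  have hY (r : ℕ) : Measurable fun ω => fun i : Fin (n + 1) => X (r + i) ω :=
    measurable_pi_iff.2 fun i => hX.measurable (r + i)
  have h₀ : Measurable fun ω => fun i : Fin (n + 1) => X i ω :=
    measurable_pi_iff.2 fun i => hX.measurable i
  have h₁ (b : Fin (n + 1) → S) :
      μ.real {ω | X 0 ω = x ∧ (fun i : Fin (n + 1) => X (r + i) ω) = b} =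
        μ.real {ω | X 0 ω = x} * (P ^ r) x (b 0) *
          ∏ i ∈ Finset.range n, P (extendPath b x i) (extendPath b x (i + 1)) := by
    have := hX.measureReal_path x r n (extendPath b x)
    simp only [forall_le_eq_extendPath_iff b x fun i => X (r + i) _] at this
    exact this
  have h₂ (b : Fin (n + 1) → S) :
      μ.real {ω | True ∧ (fun i : Fin (n + 1) => X i ω) = b} =
        μ.real {ω | X 0 ω = b 0} *
          ∏ i ∈ Finset.range n, P (extendPath b x i) (extendPath b x (i + 1)) := by
    have := hX.markov n (extendPath b x)
    simp only [forall_le_eq_extendPath_iff b x fun i => X i _] at this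
    simp only [true_and]
    exact this
  have h₃ : ∫ ω, Φ (fun i => X i ω) ∂μ =
      ∑ b, μ.real {ω | True ∧ (fun i : Fin (n + 1) => X i ω) = b} * Φ b := by
    rw [← setIntegral_comp_eq_sum h₀ Φ]
    simp
  have h₄ : ∑ b, μ.real {ω | True ∧ (fun i : Fin (n + 1) => X i ω) = b} = 1 := by
    rw [← measureReal_eq_sum_and_eq h₀ (by simp)]
    simp
  have hprod (b : Fin (n + 1) → S) :
      0 ≤ ∏ i ∈ Finset.range n, P (extendPath b x i) (extendPath b x (i + 1)) :=
    Finset.prod_nonneg fun i _ => hX.irreducible.nonneg _ _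
  -- Spread `η` over the windows `b` by their stationary probabilities. Both path laws share the
  -- transition product, so only the weights of `b 0` are compared.
  rw [setIntegral_comp_eq_sum (hY r) Φ, h₃, Finset.mul_sum, ← Finset.sum_sub_distrib,
    ← mul_one (_ * η), ← h₄, Finset.mul_sum]
  refine (Finset.abs_sum_le_sum_abs _ _).trans (Finset.sum_le_sum fun b _ => ?_)
  rw [h₁, h₂]
  set q := ∏ i ∈ Finset.range n, P (extendPath b x i) (extendPath b x (i + 1))
  have hp : 0 ≤ μ.real {ω | X 0 ω = x} := measureReal_nonneg
  calc |μ.real {ω | X 0 ω = x} * (P ^ r) x (b 0) * q * Φ b -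
          μ.real {ω | X 0 ω = x} * (μ.real {ω | X 0 ω = b 0} * q * Φ b)|
      = μ.real {ω | X 0 ω = x} * |(P ^ r) x (b 0) - μ.real {ω | X 0 ω = b 0}| * q * |Φ b| := by
        have (a u v q φ : ℝ) (ha : 0 ≤ a) (hq : 0 ≤ q) :
            |a * u * q * φ - a * (v * q * φ)| = a * |u - v| * q * |φ| := by
          rw [show a * u * q * φ - a * (v * q * φ) = a * (u - v) * q * φ by ring, abs_mul, abs_mul,
            abs_mul, abs_of_nonneg ha, abs_of_nonneg hq]
        exact this _ _ _ _ _ hp (hprod b)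
    _ ≤ μ.real {ω | X 0 ω = x} * (η * μ.real {ω | X 0 ω = b 0}) * q * 1 := by
        have := hprod b
        have := hr (b 0)
        gcongr
        · exact mul_nonneg (mul_nonneg hp ((abs_nonneg _).trans this)) (hprod b)
        · exact hΦ b
    _ = _ := by ring

end IsStationaryErgodicChain

end Chain


/-- Fubini for the product law: the freezing principle used to average over the services with the
chain held fixed. -/
theorem _root_.ProbabilityTheory.IndepFun.integral_comp_prodMk {Ω α β : Type*} [MeasurableSpace Ω]
    [MeasurableSpace α] [MeasurableSpace β] {μ : Measure Ω} [IsProbabilityMeasure μ]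
    {U : Ω → α} {V : Ω → β} (h : IndepFun U V μ) (hU : Measurable U) (hV : Measurable V)
    {f : α × β → ℝ} (hf : Measurable f) {C : ℝ} (hC : ∀ p, |f p| ≤ C) :
    ∫ ω, f (U ω, V ω) ∂μ = ∫ ω, ∫ ω', f (U ω, V ω') ∂μ ∂μ := by
  have := Measure.isProbabilityMeasure_map (μ := μ) hU.aemeasurable
  have := Measure.isProbabilityMeasure_map (μ := μ) hV.aemeasurable
  have hint : Integrable f ((μ.map U).prod (μ.map V)) :=
    .of_bound hf.aestronglyMeasurable C (.of_forall hC)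
  rw [← integral_map (f := f) (hU.prodMk hV).aemeasurable hf.aestronglyMeasurable,
    h.map_prod_eq_prod_map_map hU.aemeasurable hV.aemeasurable, integral_prod f hint,
    integral_map hU.aemeasurable hint.aestronglyMeasurable.integral_prod_right']
  refine integral_congr_ae (.of_forall fun ω => ?_)
  exact integral_map hV.aemeasurable
    (hf.comp measurable_prodMk_left).aestronglyMeasurable

/-! ### The queue as a functional of batches and services. -/

section WindowSum

variable {k K : ℕ}

/-- The discount factor `e^{-δ (l - r)} 1_{r < l}`. -/
noncomputable def discount (δ r l : ℝ) : ℝ :=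
  Real.exp (-δ * (l - r)) * if r < l then 1 else 0

theorem measurable_discount (δ r : ℝ) : Measurable (discount δ r) :=
  Measurable.mul (by fun_prop)
    (Measurable.ite measurableSet_Ioi measurable_const measurable_const)

theorem discount_nonneg (δ r l : ℝ) : 0 ≤ discount δ r l := by
  unfold discount
  split_ifs <;> positivity

theorem discount_le {δ : ℝ} (hδ : 0 ≤ δ) (r l : ℝ) : discount δ r l ≤ if r < l then 1 else 0 := by
  unfold discount
  split_ifs with h
  · rw [mul_one, Real.exp_le_one_iff]
    nlinarith
  · simp

theorem discount_of_le {r l : ℝ} (δ : ℝ) (h : l ≤ r) : discount δ r l = 0 := by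
  simp [discount, h.not_gt]

/-- The functional of the batch sizes `w 1, …, w n` and the service times `l 1, …, l n` which gives
the discounted queue at time `n` for arrivals at the times `1, 2, …`. -/
noncomputable def windowSum (δ : ℝ) (n : ℕ) (w : ℕ → State k K) (l : ℕ → Fin k → ℝ) :
    Fin k → ℝ := fun j =>
  ∑ i ∈ Finset.range n, ((w (i + 1) j : ℕ) : ℝ) * discount δ ((n : ℝ) - (i + 1)) (l (i + 1) j)

theorem measurable_windowSum {α : Type*} [MeasurableSpace α] {U : α → ℕ → State k K}
    {V : α → ℕ → Fin k → ℝ} (hU : Measurable U) (hV : Measurable V) (δ : ℝ) (n : ℕ) :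
    Measurable fun a => windowSum δ n (U a) (V a) := by
  refine measurable_pi_iff.2 fun j => Finset.measurable_fun_sum _ fun i _ => ?_
  refine Measurable.mul ?_ ((measurable_discount _ _).comp ?_)
  · exact (Measurable.of_discrete (f := fun v : Fin (K + 1) => ((v : ℕ) : ℝ))).comp
      ((measurable_pi_apply j).comp ((measurable_pi_apply (i + 1)).comp hU))
  · exact (measurable_pi_apply j).comp ((measurable_pi_apply (i + 1)).comp hV)

theorem windowSum_congr {δ : ℝ} {n : ℕ} {w w' : ℕ → State k K} {l : ℕ → Fin k → ℝ}
    (h : ∀ i ≤ n, w i = w' i) : windowSum δ n w l = windowSum δ n w' l := by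
  funext j
  refine Finset.sum_congr rfl fun i hi => ?_
  rw [h (i + 1) (Finset.mem_range.1 hi)]

theorem sum_mul_windowSum (δ : ℝ) (n : ℕ) (w : ℕ → State k K) (l : ℕ → Fin k → ℝ)
    (s : Fin k → ℝ) :
    ∑ j, s j * windowSum δ n w l j = ∑ i ∈ Finset.range n, ∑ j,
      s j * ((w (i + 1) j : ℕ) : ℝ) * discount δ ((n : ℝ) - (i + 1)) (l (i + 1) j) := by
  rw [Finset.sum_comm]
  refine Finset.sum_congr rfl fun j _ => ?_
  rw [windowSum, Finset.mul_sum]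
  simp only [mul_assoc]

/-- Replaces batches by `K` and discounts by indicators. The bound no longer involves the chain, so
its expectation factorises over the services. -/
theorem exp_sum_windowSum_le {δ : ℝ} (hδ : 0 ≤ δ) (n : ℕ) (w : ℕ → State k K)
    (l : ℕ → Fin k → ℝ) (s : Fin k → ℝ) :
    Real.exp (∑ j, s j * windowSum δ n w l j) ≤ ∏ i ∈ Finset.range n, ∏ j,
      Real.exp (|s j| * K * if (n : ℝ) - (i + 1) < l (i + 1) j then 1 else 0) := by
  rw [sum_mul_windowSum, Real.exp_sum]
  refine Finset.prod_le_prod (fun _ _ => (Real.exp_pos _).le) fun i _ => ?_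
  rw [Real.exp_sum]
  refine Finset.prod_le_prod (fun _ _ => (Real.exp_pos _).le) fun j _ => Real.exp_le_exp.2 ?_
  have h₁ : ((w (i + 1) j : ℕ) : ℝ) ≤ K := Nat.cast_le.2 (Fin.is_le _)
  have h₂ := discount_nonneg δ ((n : ℝ) - (i + 1)) (l (i + 1) j)
  have h₃ := discount_le hδ ((n : ℝ) - (i + 1)) (l (i + 1) j)
  have h₄ := le_abs_self (s j)
  gcongr

/-- A crude bound growing with `n`, for integrability at a fixed time only. -/
theorem exp_sum_windowSum_le_const {δ : ℝ} (hδ : 0 ≤ δ) (n : ℕ) (w : ℕ → State k K)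
    (l : ℕ → Fin k → ℝ) (s : Fin k → ℝ) :
    Real.exp (∑ j, s j * windowSum δ n w l j) ≤
      ∏ _i ∈ Finset.range n, ∏ j, Real.exp (|s j| * K) := by
  refine (exp_sum_windowSum_le hδ n w l s).trans ?_
  refine Finset.prod_le_prod (fun _ _ => Finset.prod_nonneg fun _ _ => (Real.exp_pos _).le)
    fun i _ => Finset.prod_le_prod (fun _ _ => (Real.exp_pos _).le) fun j _ =>
      Real.exp_le_exp.2 ?_
  refine mul_le_of_le_one_right (by positivity) ?_
  split_ifs <;> norm_num

/-- The window of the last `n` arrivals determines the discounted queue, unless one of the earlier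
customers is still present. -/
theorem windowSum_add (δ : ℝ) (r n : ℕ) (w : ℕ → State k K) (l : ℕ → Fin k → ℝ)
    (h : ∀ i < r, ∀ j, l (i + 1) j ≤ ((n + (r - 1 - i) : ℕ) : ℝ)) :
    windowSum δ (r + n) w l = windowSum δ n (fun i => w (r + i)) (fun i => l (r + i)) := by
  funext j
  rw [windowSum, Finset.sum_range_add, Finset.sum_eq_zero, zero_add]
  · refine Finset.sum_congr rfl fun i _ => ?_
    rw [add_assoc]
    congr 2
    push_cast
    ring
  · intro i hi
    rw [Finset.mem_range] at hi
    rw [discount_of_le, mul_zero]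
    have := h i hi j
    -- The customer arriving at `i + 1` has age `r + n - (i + 1)` at time `r + n`; since `i < r`,
    -- the natural subtractions are exact.
    rw [Nat.cast_add, Nat.cast_sub (by omega), Nat.cast_sub (by omega)] at this
    push_cast at this ⊢
    linarith

end WindowSum

/-! ### Ordered matrix products. -/

section OrderedProd

variable {S : Type*} [Fintype S] [DecidableEq S]

theorem orderedProd_congr {A B : ℕ → Matrix S S ℝ} {n : ℕ} (h : ∀ m < n, A m = B m) :
    orderedProd A n = orderedProd B n := by
  unfold orderedProd
  rw [List.map_congr_left fun m hm => h m (List.mem_range.1 hm)]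

theorem transpose_orderedProd (A : ℕ → Matrix S S ℝ) (n : ℕ) :
    (orderedProd A n).transpose = orderedProd (fun m => (A (n - 1 - m)).transpose) n := by
  unfold orderedProd
  rw [Matrix.transpose_list_prod]
  congr 1
  refine List.ext_getElem (by simp) fun i h₁ h₂ => ?_
  simp

end OrderedProd

/-! ### Deterministic arrivals and the transient mgf. -/

namespace IsModel

variable {Ω : Type*} [MeasurableSpace Ω] {μ : Measure Ω} {k K : ℕ}
  {P : Matrix (State k K) (State k K) ℝ} {X : ℕ → Ω → State k K}
  {L : ℕ → Fin k → Ω → ℝ} {T : ℕ → Ω → ℝ}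

theorem measurable_path (h : IsModel μ P X L T) : Measurable fun ω i => X i ω :=
  measurable_pi_iff.2 h.chain.measurable

theorem measurable_services (h : IsModel μ P X L T) (r : ℕ) :
    Measurable fun ω i j => L (r + i) j ω :=
  measurable_pi_iff.2 fun i => measurable_pi_iff.2 fun j => h.measurable_L (r + i) j

theorem indepFun_services (h : IsModel μ P X L T) (r : ℕ) :
    IndepFun (fun ω i => X i ω) (fun ω i j => L (r + i) j ω) μ := by
  have hφ : Measurable fun (p : (ℕ → ℝ) × (ℕ → Fin k → ℝ)) (i : ℕ) => p.2 (r + i) :=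
    measurable_pi_iff.2 fun i => (measurable_pi_apply (r + i)).comp measurable_snd
  exact h.indepFun_X.comp measurable_id hφ

/-- Every increment has the law of `T 1`, hence equals 1 almost surely; then telescope. -/
theorem ae_arrival_eq (h : IsModel μ P X L T) (hτ : ∀ᵐ ω ∂μ, T 1 ω = 1) :
    ∀ᵐ ω ∂μ, ∀ i, T i ω = i := by
  have hinc : ∀ᵐ ω ∂μ, ∀ i, T (i + 1) ω - T i ω = 1 :=
    ae_all_iff.2 fun i =>
      (h.identDistrib_increments i).symm.ae_snd (p := fun a => a = 1) (measurableSet_singleton 1) hτ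
  filter_upwards [hinc, h.T_zero] with ω h₁ h₀ i
  induction i with
  | zero => simp [h₀]
  | succ i ih =>
    push_cast
    linarith [h₁ i]

omit [MeasurableSpace Ω] in
theorem arrivals_natCast {ω : Ω} (h : ∀ i, T i ω = i) (t : ℕ) : arrivals T (t : ℝ) ω = t := by
  have : {i : ℕ | 1 ≤ i ∧ T i ω ≤ (t : ℝ)} = (Finset.Icc 1 t : Finset ℕ) := by
    ext i
    simp [h i]
  rw [arrivals, this, Set.ncard_coe_finset, Nat.card_Icc, Nat.add_sub_cancel]

theorem sum_Icc_one_eq_sum_range (f : ℕ → ℝ) (t : ℕ) :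
    ∑ i ∈ Finset.Icc 1 t, f i = ∑ i ∈ Finset.range t, f (i + 1) := by
  induction t with
  | zero => simp
  | succ t ih => rw [Finset.sum_Icc_succ_top (by omega), ih, Finset.sum_range_succ]

omit [MeasurableSpace Ω] in
-- The factor `e^{δ t}` turns `e^{-δ (L + i)}` into `e^{-δ (L - (t - i))}`, a function of the
-- service time and the age `t - i`.
theorem Ztilde_eq_windowSum (δ : ℝ) {ω : Ω} (h : ∀ i, T i ω = i) (t : ℕ) :
    Ztilde δ X L T (t : ℝ) ω = windowSum δ t (fun i => X i ω) (fun i j => L i j ω) := by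
  funext j
  rw [Ztilde, Z, arrivals_natCast h, sum_Icc_one_eq_sum_range, windowSum, Finset.mul_sum]
  refine Finset.sum_congr rfl fun i _ => ?_
  rw [h, discount, show -δ * (L (i + 1) j ω - ((t : ℝ) - (i + 1))) =
    δ * t + -δ * (L (i + 1) j ω + ((i + 1 : ℕ) : ℝ)) by push_cast; ring, Real.exp_add]
  have : ((t : ℝ) < L (i + 1) j ω + ((i + 1 : ℕ) : ℝ)) ↔ (t : ℝ) - (i + 1) < L (i + 1) j ω := by
    push_cast
    exact sub_lt_iff_lt_add.symm
  simp only [this]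
  ring

theorem ae_prodMk_eq (h : IsModel μ P X L T) (hτ : ∀ᵐ ω ∂μ, T 1 ω = 1) (δ : ℝ) (t : ℕ) :
    (fun ω => (Ztilde δ X L T (t : ℝ) ω, stateAt X T (t : ℝ) ω)) =ᵐ[μ]
      fun ω => (windowSum δ t (fun i => X i ω) (fun i j => L i j ω), X t ω) := by
  filter_upwards [h.ae_arrival_eq hτ] with ω hω
  rw [Ztilde_eq_windowSum δ hω, stateAt, arrivals_natCast hω]

theorem measurable_windowSum_path (h : IsModel μ P X L T) (δ : ℝ) (t : ℕ) :
    Measurable fun ω => windowSum δ t (fun i => X i ω) (fun i j => L i j ω) := by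
  have hL := h.measurable_services 0
  simp only [zero_add] at hL
  exact measurable_windowSum h.measurable_path hL δ t

variable [IsProbabilityMeasure μ]

omit [IsProbabilityMeasure μ] in
theorem integral_prod_services (h : IsModel μ P X L T) (t : ℕ) {f : ℕ → Fin k → ℝ → ℝ}
    (hf : ∀ i j, Measurable (f i j)) :
    ∫ ω, ∏ i ∈ Finset.range t, ∏ j, f i j (L (i + 1) j ω) ∂μ =
      ∏ i ∈ Finset.range t, ∏ j, ∫ ω, f i j (L 0 j ω) ∂μ := by
  -- Customers are numbered from 1; index 0 is reserved for the generic service vector.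
  let g : Fin t × Fin k → ℕ × Fin k := fun p => (p.1 + 1, p.2)
  have hg : Function.Injective g := by
    rintro ⟨a, b⟩ ⟨c, d⟩ h
    simp only [g, Prod.mk.injEq, add_left_inj] at h
    exact Prod.ext (Fin.ext h.1) h.2
  have key := (h.iIndepFun_L.precomp hg).integral_fun_prod_comp (f := fun p => f p.1 p.2)
    (fun p => (h.measurable_L _ _).aemeasurable)
    (fun p => (hf p.1 p.2).aestronglyMeasurable)
  simp only [Fintype.prod_prod_type, g] at key
  simp only [Finset.prod_range]
  rw [key]
  refine Finset.prod_congr rfl fun i _ => Finset.prod_congr rfl fun j _ => ?_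
  exact ((h.identDistrib_L (i + 1) j).comp (hf i j)).integral_eq

omit [IsProbabilityMeasure μ] in
theorem integral_exp_sum_services (h : IsModel μ P X L T) {f : Fin k → ℝ → ℝ}
    (hf : ∀ j, Measurable (f j)) :
    ∫ ω, Real.exp (∑ j, f j (L 0 j ω)) ∂μ = ∏ j, ∫ ω, Real.exp (f j (L 0 j ω)) ∂μ := by
  have hg : Function.Injective fun j : Fin k => ((0 : ℕ), j) := fun a b h => (Prod.mk.inj h).2
  have key := (h.iIndepFun_L.precomp hg).integral_fun_prod_comp (f := fun j a => Real.exp (f j a))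
    (fun p => (h.measurable_L _ _).aemeasurable)
    (fun j => (hf j).exp.aestronglyMeasurable)
  simpa only [Real.exp_sum] using key

omit [IsProbabilityMeasure μ] in
theorem integral_exp_windowSum (h : IsModel μ P X L T) (δ : ℝ) (s : Fin k → ℝ) (t : ℕ)
    (w : ℕ → State k K) :
    ∫ ω, Real.exp (∑ j, s j * windowSum δ t w (fun i j => L i j ω) j) ∂μ =
      ∏ i ∈ Finset.range t,
        piTilde μ K δ (L 0) s ((t : ℝ) - (i + 1)) (w (i + 1)) (w (i + 1)) := by
  have hmeas (i : ℕ) (j : Fin k) : Measurable fun l : ℝ =>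
      s j * ((w (i + 1) j : ℕ) : ℝ) * discount δ ((t : ℝ) - (i + 1)) l :=
    (measurable_discount _ _).const_mul _
  simp only [sum_mul_windowSum, Real.exp_sum]
  rw [h.integral_prod_services t fun i j => (hmeas i j).exp]
  refine Finset.prod_congr rfl fun i _ => ?_
  rw [piTilde, Matrix.diagonal_apply_eq, ← h.integral_exp_sum_services (hmeas i)]
  simp only [discount, mul_assoc]

/-- Core of part 1: freeze the chain, average over the services to get a product of `π̃` entries
along the path, then apply the Markov recursion `setIntegral_prod`. -/
theorem setIntegral_exp_windowSum (h : IsModel μ P X L T) {δ : ℝ} (hδ : 0 ≤ δ) (s : Fin k → ℝ)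
    (t : ℕ) (x y : State k K) :
    ∫ ω in {ω | X 0 ω = x},
        Real.exp (∑ j, s j * windowSum δ t (fun i => X i ω) (fun i j => L i j ω) j) *
          (if X t ω = y then 1 else 0) ∂μ =
      μ.real {ω | X 0 ω = x} * orderedProd
        (fun m => (Qtilde μ δ P (L 0) s ((t : ℝ) - ((m : ℝ) + 1))).transpose) t x y := by
  let c : ℕ → State k K → ℝ := fun i v => piTilde μ K δ (L 0) s ((t : ℝ) - (i + 1)) v v
  have hQ (m : ℕ) : (Qtilde μ δ P (L 0) s ((t : ℝ) - ((m : ℝ) + 1))).transpose =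
      P * Matrix.diagonal (c m) := by
    rw [Qtilde, Matrix.transpose_mul, Matrix.transpose_transpose]
    simp only [c, piTilde, Matrix.diagonal_transpose, Matrix.diagonal_apply_eq]
  simp only [hQ]
  rw [← h.chain.setIntegral_prod c x y t, ← integral_indicator (h.chain.measurableSet_eq 0 x),
    ← integral_indicator (h.chain.measurableSet_eq t y)]
  let f : (ℕ → State k K) × (ℕ → Fin k → ℝ) → ℝ := fun p =>
    (if p.1 0 = x then 1 else 0) * (if p.1 t = y then 1 else 0) *
      Real.exp (∑ j, s j * windowSum δ t p.1 p.2 j)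
  have hite (i : ℕ) (z : State k K) : Measurable fun p : (ℕ → State k K) × (ℕ → Fin k → ℝ) =>
      if p.1 i = z then (1 : ℝ) else 0 :=
    Measurable.ite (measurableSet_eq_fun ((measurable_pi_apply i).comp measurable_fst)
      measurable_const) measurable_const measurable_const
  have hf : Measurable f := by
    refine ((hite 0 x).mul (hite t y)).mul (Measurable.exp ?_)
    exact Finset.measurable_fun_sum _ fun j _ =>
      ((measurable_pi_apply j).comp (measurable_windowSum measurable_fst measurable_snd δ t)).const_mul _
  have hL := h.measurable_services 0
  have hind := h.indepFun_services 0
  simp only [zero_add] at hL hind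
  have key := hind.integral_comp_prodMk h.measurable_path hL hf
    (C := ∏ _i ∈ Finset.range t, ∏ j, Real.exp (|s j| * K)) fun p => by
      refine le_trans ?_ (exp_sum_windowSum_le_const hδ t p.1 p.2 s)
      simp only [f]
      split_ifs <;> simp [(Real.exp_pos _).le]
  simp only [f] at key
  convert key using 2
  · funext ω
    by_cases h₀ : X 0 ω = x <;> by_cases h₁ : X t ω = y <;> simp [Set.indicator, h₀, h₁]
  · funext ω
    by_cases h₀ : X 0 ω = x <;> by_cases h₁ : X t ω = y <;> simp [Set.indicator, h₀, h₁, c]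
    exact (h.integral_exp_windowSum δ s t fun i => X i ω).symm

theorem isProbabilityMeasure_condInit (h : IsModel μ P X L T) (x : State k K) :
    IsProbabilityMeasure (condInit μ X x) :=
  cond_isProbabilityMeasure fun h₀ => (h.chain.init_pos x).ne' (by simp [measureReal_def, h₀])

omit [IsProbabilityMeasure μ] in
theorem integral_condInit (X : ℕ → Ω → State k K) (x : State k K) (f : Ω → ℝ) :
    ∫ ω, f ω ∂(condInit μ X x) =
      (μ.real {ω | X 0 ω = x})⁻¹ * ∫ ω in {ω | X 0 ω = x}, f ω ∂μ := by
  rw [condInit, ProbabilityTheory.cond, integral_smul_measure, ENNReal.toReal_inv, smul_eq_mul]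
  rfl

omit [IsProbabilityMeasure μ] in
theorem ae_condInit {x : State k K} {p : Ω → Prop} (h : ∀ᵐ ω ∂μ, p ω) :
    ∀ᵐ ω ∂(condInit μ X x), p ω :=
  cond_absolutelyContinuous.ae_le h

omit [IsProbabilityMeasure μ] in
theorem integrable_exp_windowSum (h : IsModel μ P X L T) {δ : ℝ} (hδ : 0 ≤ δ) (s : Fin k → ℝ)
    (t : ℕ) (κ : Measure Ω) [IsFiniteMeasure κ] :
    Integrable (fun ω => Real.exp
      (∑ j, s j * windowSum δ t (fun i => X i ω) (fun i j => L i j ω) j)) κ := by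
  have hW := h.measurable_windowSum_path δ t
  refine .of_bound (Measurable.aestronglyMeasurable (Measurable.exp
    (Finset.measurable_fun_sum _ fun j _ => ((measurable_pi_apply j).comp hW).const_mul _)))
    (∏ _i ∈ Finset.range t, ∏ j, Real.exp (|s j| * K)) (.of_forall fun ω => ?_)
  rw [Real.norm_of_nonneg (Real.exp_pos _).le]
  exact exp_sum_windowSum_le_const hδ t _ _ s

theorem integrable_exp_Ztilde (h : IsModel μ P X L T) (hτ : ∀ᵐ ω ∂μ, T 1 ω = 1) {δ : ℝ}
    (hδ : 0 ≤ δ) (s : Fin k → ℝ) (t : ℕ) (x : State k K) :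
    Integrable (fun ω => Real.exp (∑ j, s j * Ztilde δ X L T (t : ℝ) ω j)) (condInit μ X x) := by
  have := h.isProbabilityMeasure_condInit x
  refine (h.integrable_exp_windowSum hδ s t (condInit μ X x)).congr ?_
  filter_upwards [ae_condInit (h.ae_arrival_eq hτ)] with ω hω
  rw [Ztilde_eq_windowSum δ hω]

theorem psiTilde_eq_orderedProd_transpose (h : IsModel μ P X L T) (hτ : ∀ᵐ ω ∂μ, T 1 ω = 1)
    {δ : ℝ} (hδ : 0 ≤ δ) (s : Fin k → ℝ) (t : ℕ) :
    psiTilde μ δ X L T s (t : ℝ) = orderedProd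
      (fun m => (Qtilde μ δ P (L 0) s ((t : ℝ) - ((m : ℝ) + 1))).transpose) t := by
  ext x y
  have hae : ∀ᵐ ω ∂(condInit μ X x), Real.exp (∑ j, s j * Ztilde δ X L T (t : ℝ) ω j) *
      (if stateAt X T (t : ℝ) ω = y then 1 else 0) =
      Real.exp (∑ j, s j * windowSum δ t (fun i => X i ω) (fun i j => L i j ω) j) *
          (if X t ω = y then 1 else 0) := by
    filter_upwards [ae_condInit (h.ae_arrival_eq hτ)] with ω hω
    rw [Ztilde_eq_windowSum δ hω, stateAt, arrivals_natCast hω]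
  rw [psiTilde, Matrix.of_apply, integral_congr_ae hae, integral_condInit,
    h.setIntegral_exp_windowSum hδ, inv_mul_cancel_left₀ (h.chain.init_pos x).ne']

omit [IsProbabilityMeasure μ] in
-- Index `m` becomes `t - 1 - m`: the first factor after transposition belongs to the oldest
-- customer.
theorem transpose_orderedProd_Qtilde (μ : Measure Ω) (δ : ℝ)
    (P : Matrix (State k K) (State k K) ℝ) (G : Fin k → Ω → ℝ) (s : Fin k → ℝ) (t : ℕ) :
    (orderedProd (fun m => Qtilde μ δ P G s (m : ℝ)) t).transpose = orderedProd
      (fun m => (Qtilde μ δ P G s ((t : ℝ) - ((m : ℝ) + 1))).transpose) t := by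
  rw [transpose_orderedProd]
  refine orderedProd_congr fun m hm => ?_
  rw [Nat.cast_sub (by omega), Nat.cast_sub (by omega), Nat.cast_one, sub_sub, add_comm (1 : ℝ)]

end IsModel


/-! ### Uniform mgf bounds and comparison in total variation. -/

theorem _root_.ProbabilityTheory.IndepFun.measureReal_prodMk_mem {Ω α β : Type*}
    [MeasurableSpace Ω] [MeasurableSpace α] [MeasurableSpace β] {μ : Measure Ω}
    [IsProbabilityMeasure μ] {U : Ω → α} {V : Ω → β} (h : IndepFun U V μ) (hU : Measurable U)
    (hV : Measurable V) {E : Set (α × β)} (hE : MeasurableSet E) :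
    μ.real {ω | (U ω, V ω) ∈ E} = ∫ ω, μ.real {ω' | (U ω, V ω') ∈ E} ∂μ := by
  have key := h.integral_comp_prodMk hU hV (f := E.indicator 1) (measurable_one.indicator hE)
    (C := 1) fun p => by
      by_cases hp : p ∈ E <;> simp [hp]
  have h₁ : ∫ ω, E.indicator (1 : α × β → ℝ) (U ω, V ω) ∂μ = μ.real {ω | (U ω, V ω) ∈ E} :=
    integral_indicator_one (hU.prodMk hV hE)
  have h₂ (ω : Ω) : ∫ ω', E.indicator (1 : α × β → ℝ) (U ω, V ω') ∂μ =
      μ.real {ω' | (U ω, V ω') ∈ E} :=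
    integral_indicator_one ((measurable_const.prodMk hV) hE)
  simpa only [h₁, h₂] using key

theorem abs_measureReal_sub_le {Ω : Type*} [MeasurableSpace Ω] {μ : Measure Ω} [IsFiniteMeasure μ]
    {A B C : Set Ω} (h₁ : A ⊆ B ∪ C) (h₂ : B ⊆ A ∪ C) : |μ.real A - μ.real B| ≤ μ.real C := by
  have h₃ := (measureReal_mono (μ := μ) h₁).trans (measureReal_union_le B C)
  have h₄ := (measureReal_mono (μ := μ) h₂).trans (measureReal_union_le A C)
  rw [abs_le]
  constructor <;> linarith

theorem integral_exp_mul_ite_lt {Ω : Type*} [MeasurableSpace Ω] {μ : Measure Ω}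
    [IsProbabilityMeasure μ] {Y : Ω → ℝ} (hY : Measurable Y) (a r : ℝ) :
    ∫ ω, Real.exp (a * if r < Y ω then 1 else 0) ∂μ =
      1 + (Real.exp a - 1) * μ.real {ω | r < Y ω} := by
  have hm : MeasurableSet {ω | r < Y ω} := hY measurableSet_Ioi
  have h (ω : Ω) : Real.exp (a * if r < Y ω then 1 else 0) =
      1 + (Real.exp a - 1) * {ω | r < Y ω}.indicator 1 ω := by
    by_cases h : r < Y ω <;> simp [Set.indicator, h]
  simp only [h]
  rw [integral_add (integrable_const _)
    (((integrable_indicator_iff hm).2 (integrableOn_const (by simp))).const_mul _),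
    integral_const_mul, integral_indicator_one hm]
  simp

theorem summable_measureReal_natCast_lt {Ω : Type*} [MeasurableSpace Ω] {μ : Measure Ω}
    [IsProbabilityMeasure μ] {Y : Ω → ℝ} (hY : Integrable Y μ) :
    Summable fun m : ℕ => μ.real {ω | (m : ℝ) < Y ω} := by
  -- Service times may be negative, so the tail sum is taken for `|Y|`, which dominates.
  have key := @tsum_prob_mem_Ioi_lt_top Ω ⟨μ⟩ ‹_› (fun ω => |Y ω|) hY.abs fun ω => abs_nonneg _
  refine ENNReal.summable_toReal (ne_top_of_le_ne_top key.ne ?_)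
  exact ENNReal.tsum_le_tsum fun m => measure_mono fun ω hω =>
    show (m : ℝ) < |Y ω| from lt_of_lt_of_le hω (le_abs_self _)

namespace IsModel

variable {Ω : Type*} [MeasurableSpace Ω] {μ : Measure Ω} [IsProbabilityMeasure μ] {k K : ℕ}
  {P : Matrix (State k K) (State k K) ℝ} {X : ℕ → Ω → State k K}
  {L : ℕ → Fin k → Ω → ℝ} {T : ℕ → Ω → ℝ}

theorem summable_tail (hL : ∀ j, Integrable (L 0 j) μ) :
    Summable fun m : ℕ => ∑ j, μ.real {ω | (m : ℝ) < L 0 j ω} :=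
  summable_sum fun j _ => summable_measureReal_natCast_lt (hL j)

/-- A bound, uniform in time, for the moment generating function of the discounted queue. -/
theorem exists_integral_exp_windowSum_le (h : IsModel μ P X L T) {δ : ℝ} (hδ : 0 ≤ δ)
    (hL : ∀ j, Integrable (L 0 j) μ) (s : Fin k → ℝ) :
    ∃ C, ∀ t, ∫ ω, Real.exp
      (∑ j, s j * windowSum δ t (fun i => X i ω) (fun i j => L i j ω) j) ∂μ ≤ C := by
  let q : Fin k → ℕ → ℝ := fun j m => μ.real {ω | (m : ℝ) < L 0 j ω}
  have hq (j : Fin k) : Summable (q j) := summable_measureReal_natCast_lt (hL j)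
  let a : Fin k → ℝ := fun j => Real.exp (|s j| * K) - 1
  have ha (j : Fin k) : 0 ≤ a j := sub_nonneg.2 (Real.one_le_exp (by positivity))
  -- Each service contributes at most `1 + a j * q j m ≤ exp (a j * q j m)`, where `m` is the
  -- customer's age; the ages at time `t` run over `0, …, t - 1`.
  refine ⟨Real.exp (∑ j, a j * ∑' m, q j m), fun t => ?_⟩
  have hW := h.measurable_windowSum_path δ t
  have hmeas (i : ℕ) (j : Fin k) : Measurable fun l : ℝ =>
      Real.exp (|s j| * K * if (t : ℝ) - (i + 1) < l then 1 else 0) :=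
    ((Measurable.ite measurableSet_Ioi measurable_const measurable_const).const_mul _).exp
  calc ∫ ω, Real.exp (∑ j, s j * windowSum δ t (fun i => X i ω) (fun i j => L i j ω) j) ∂μ
      ≤ ∫ ω, ∏ i ∈ Finset.range t, ∏ j,
          Real.exp (|s j| * K * if (t : ℝ) - (i + 1) < L (i + 1) j ω then 1 else 0) ∂μ := by
        refine integral_mono_of_nonneg (.of_forall fun _ => (Real.exp_pos _).le) ?_
          (.of_forall fun ω => exp_sum_windowSum_le hδ t _ _ s)
        refine .of_bound (Measurable.aestronglyMeasurable (Finset.measurable_fun_prod _ fun i _ =>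
          Finset.measurable_fun_prod _ fun j _ => (hmeas i j).comp (h.measurable_L (i + 1) j)))
          (∏ _i ∈ Finset.range t, ∏ j, Real.exp (|s j| * K)) (.of_forall fun ω => ?_)
        rw [Real.norm_of_nonneg (Finset.prod_nonneg fun _ _ => Finset.prod_nonneg fun _ _ =>
          (Real.exp_pos _).le)]
        refine Finset.prod_le_prod (fun _ _ => Finset.prod_nonneg fun _ _ => (Real.exp_pos _).le)
          fun i _ => Finset.prod_le_prod (fun _ _ => (Real.exp_pos _).le) fun j _ =>
            Real.exp_le_exp.2 (mul_le_of_le_one_right (by positivity) ?_)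
        split_ifs <;> norm_num
    _ = ∏ i ∈ Finset.range t, ∏ j, (1 + a j * q j (t - 1 - i)) := by
        rw [h.integral_prod_services t hmeas]
        refine Finset.prod_congr rfl fun i hi => Finset.prod_congr rfl fun j _ => ?_
        rw [Finset.mem_range] at hi
        rw [integral_exp_mul_ite_lt (h.measurable_L 0 j)]
        simp only [a, q]
        rw [Nat.cast_sub (by omega), Nat.cast_sub (by omega), Nat.cast_one, sub_sub,
          add_comm (1 : ℝ) (i : ℝ)]
    _ = ∏ i ∈ Finset.range t, ∏ j, (1 + a j * q j i) :=
        Finset.prod_range_reflect (fun i => ∏ j, (1 + a j * q j i)) t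
    _ ≤ ∏ i ∈ Finset.range t, ∏ j, Real.exp (a j * q j i) := by
        refine Finset.prod_le_prod (fun i _ => Finset.prod_nonneg fun j _ => ?_) fun i _ =>
          Finset.prod_le_prod (fun j _ => ?_) fun j _ => ?_
        · exact add_nonneg zero_le_one (mul_nonneg (ha j) measureReal_nonneg)
        · exact add_nonneg zero_le_one (mul_nonneg (ha j) measureReal_nonneg)
        · rw [add_comm]
          exact Real.add_one_le_exp _
    _ = Real.exp (∑ j, a j * ∑ i ∈ Finset.range t, q j i) := by
        rw [Finset.prod_comm, Real.exp_sum]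
        refine Finset.prod_congr rfl fun j _ => ?_
        rw [← Real.exp_sum, Finset.mul_sum]
    _ ≤ Real.exp (∑ j, a j * ∑' m, q j m) := by
        refine Real.exp_le_exp.2 (Finset.sum_le_sum fun j _ => ?_)
        exact mul_le_mul_of_nonneg_left
          ((hq j).sum_le_tsum _ fun m _ => measureReal_nonneg) (ha j)

/-- The probability that one of the first `r` customers is still present at time `r + n`. -/
theorem measureReal_exists_lt_le (h : IsModel μ P X L T) (hL : ∀ j, Integrable (L 0 j) μ)
    (r n : ℕ) :
    μ.real {ω | ∃ i < r, ∃ j, ((n + (r - 1 - i) : ℕ) : ℝ) < L (i + 1) j ω} ≤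
      ∑' m : ℕ, ∑ j, μ.real {ω | ((m + n : ℕ) : ℝ) < L 0 j ω} := by
  have hset : {ω | ∃ i < r, ∃ j, ((n + (r - 1 - i) : ℕ) : ℝ) < L (i + 1) j ω} =
      ⋃ i ∈ Finset.range r, ⋃ j ∈ (Finset.univ : Finset (Fin k)),
        {ω | ((n + (r - 1 - i) : ℕ) : ℝ) < L (i + 1) j ω} := by
    ext ω
    simp
  have hs := (summable_nat_add_iff n).2 (summable_tail hL)
  rw [hset]
  calc _ ≤ ∑ i ∈ Finset.range r, ∑ j, μ.real {ω | ((n + (r - 1 - i) : ℕ) : ℝ) < L (i + 1) j ω} :=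
        (measureReal_biUnion_finset_le _ _).trans
          (Finset.sum_le_sum fun i _ => measureReal_biUnion_finset_le _ _)
    _ = ∑ i ∈ Finset.range r, ∑ j, μ.real {ω | (((r - 1 - i) + n : ℕ) : ℝ) < L 0 j ω} := by
        refine Finset.sum_congr rfl fun i _ => Finset.sum_congr rfl fun j _ => ?_
        rw [add_comm n]
        exact congrArg ENNReal.toReal ((h.identDistrib_L (i + 1) j).measure_mem_eq measurableSet_Ioi)
    _ = ∑ i ∈ Finset.range r, ∑ j, μ.real {ω | ((i + n : ℕ) : ℝ) < L 0 j ω} :=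
        Finset.sum_range_reflect (fun i => ∑ j, μ.real {ω | ((i + n : ℕ) : ℝ) < L 0 j ω}) r
    _ ≤ _ := hs.sum_le_tsum _ fun m _ => Finset.sum_nonneg fun j _ => measureReal_nonneg

omit [IsProbabilityMeasure μ] in
-- The whole array is independent with laws not depending on the customer, so its joint law is shift
-- invariant.
theorem identDistrib_services (h : IsModel μ P X L T) (r : ℕ) :
    IdentDistrib (fun ω i j => L (r + i) j ω) (fun ω i j => L i j ω) μ μ := by
  have hg : Function.Injective fun p : ℕ × Fin k => (r + p.1, p.2) := by
    rintro ⟨a, b⟩ ⟨c, d⟩ h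
    simp only [Prod.mk.injEq, add_right_inj] at h
    exact Prod.ext h.1 h.2
  have key : IdentDistrib (fun ω (p : ℕ × Fin k) => L (r + p.1) p.2 ω)
      (fun ω (p : ℕ × Fin k) => L p.1 p.2 ω) μ μ :=
    IdentDistrib.pi (fun p => (h.identDistrib_L (r + p.1) p.2).trans (h.identDistrib_L p.1 p.2).symm)
      (h.iIndepFun_L.precomp hg) h.iIndepFun_L
  have hφ : Measurable fun (l : ℕ × Fin k → ℝ) (i : ℕ) (j : Fin k) => l (i, j) :=
    measurable_pi_iff.2 fun i => measurable_pi_iff.2 fun j => measurable_pi_apply (i, j)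
  exact key.comp hφ

/-- The probability of a window event given the batch sizes. -/
noncomputable def windowProb (μ : Measure Ω) (L : ℕ → Fin k → Ω → ℝ) (δ : ℝ) (n : ℕ)
    (A : Set ((Fin k → ℝ) × State k K)) (w : ℕ → State k K) : ℝ :=
  μ.real {ω | (windowSum δ n w (fun i j => L i j ω), w n) ∈ A}

/-- Freezing the chain and shifting the services back to index 0 leaves a functional of the batches
alone. `D` allows both `X 0 = x` and no conditioning. -/
theorem measureReal_window_mem (h : IsModel μ P X L T) (δ : ℝ) (r n : ℕ)
    {A : Set ((Fin k → ℝ) × State k K)} (hA : MeasurableSet A) {D : Set (ℕ → State k K)}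
    (hD : MeasurableSet D) :
    μ.real {ω | (fun i => X i ω) ∈ D ∧ (windowSum δ n (fun i => X (r + i) ω)
        (fun i j => L (r + i) j ω), X (r + n) ω) ∈ A} =
      ∫ ω in {ω | (fun i => X i ω) ∈ D},
        windowProb μ L δ n A (fun i => X (r + i) ω) ∂μ := by
  let E : Set ((ℕ → State k K) × (ℕ → Fin k → ℝ)) :=
    {p | p.1 ∈ D ∧ (windowSum δ n (fun i => p.1 (r + i)) p.2, p.1 (r + n)) ∈ A}
  have hshift : Measurable fun (p : (ℕ → State k K) × (ℕ → Fin k → ℝ)) (i : ℕ) => p.1 (r + i) :=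
    measurable_pi_iff.2 fun i => (measurable_pi_apply (r + i)).comp measurable_fst
  have hE : MeasurableSet E :=
    (measurable_fst hD).inter (((measurable_windowSum hshift measurable_snd δ n).prodMk
      ((measurable_pi_apply (r + n)).comp measurable_fst)) hA)
  have key := (h.indepFun_services r).measureReal_prodMk_mem h.measurable_path
    (h.measurable_services r) hE
  refine key.trans ?_
  have hD' : MeasurableSet {ω | (fun i => X i ω) ∈ D} := h.measurable_path hD
  rw [← integral_indicator hD']
  refine integral_congr_ae (.of_forall fun ω => ?_)
  by_cases hω : (fun i => X i ω) ∈ D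
  · rw [Set.indicator_of_mem (show ω ∈ {ω | (fun i => X i ω) ∈ D} from hω)]
    have hm : MeasurableSet {l : ℕ → Fin k → ℝ |
        (windowSum δ n (fun i => X (r + i) ω) l, X (r + n) ω) ∈ A} :=
      ((measurable_windowSum measurable_const measurable_id δ n).prodMk measurable_const) hA
    have := congrArg ENNReal.toReal ((h.identDistrib_services r).measure_mem_eq hm)
    refine Eq.trans ?_ this
    refine congrArg μ.real ?_
    ext ω'
    exact and_iff_right hω
  · rw [Set.indicator_of_notMem (show ω ∉ {ω | (fun i => X i ω) ∈ D} from hω)]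
    convert measureReal_empty (μ := μ)
    exact Set.eq_empty_of_forall_notMem fun ω' h' => hω h'.1

omit [IsProbabilityMeasure μ] in
-- Only `w 0, …, w n` matter, which puts `windowProb` in the form needed for the comparison of
-- finite windows.
theorem windowProb_eq_extendPath (L : ℕ → Fin k → Ω → ℝ) (δ : ℝ) (n : ℕ)
    (A : Set ((Fin k → ℝ) × State k K)) (w : ℕ → State k K) (y : State k K) :
    windowProb μ L δ n A w =
      windowProb μ L δ n A (extendPath (fun i : Fin (n + 1) => w i) y) := by
  have hw (i : ℕ) (hi : i ≤ n) : w i = extendPath (fun i : Fin (n + 1) => w i) y i :=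
    (extendPath_of_le (fun i : Fin (n + 1) => w i) y hi).symm
  simp only [windowProb]
  rw [← hw n le_rfl]
  simp only [windowSum_congr hw]

/-- Given `X 0 = x`, the law of the discounted queue at time `r + n` is close in total variation
to the unconditional law at time `n`. -/
theorem abs_measureReal_sub_le (h : IsModel μ P X L T) (δ : ℝ) (hL : ∀ j, Integrable (L 0 j) μ)
    (x : State k K) {η : ℝ} {r : ℕ}
    (hr : ∀ z, |(P ^ r) x z - μ.real {ω | X 0 ω = z}| ≤ η * μ.real {ω | X 0 ω = z}) (n : ℕ)
    {A : Set ((Fin k → ℝ) × State k K)} (hA : MeasurableSet A) :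
    |μ.real {ω | X 0 ω = x ∧ (windowSum δ (r + n) (fun i => X i ω)
          (fun i j => L i j ω), X (r + n) ω) ∈ A} -
        μ.real {ω | X 0 ω = x} *
          μ.real {ω | (windowSum δ n (fun i => X i ω) (fun i j => L i j ω), X n ω) ∈ A}| ≤
      ∑' m : ℕ, ∑ j, μ.real {ω | ((m + n : ℕ) : ℝ) < L 0 j ω} +
        μ.real {ω | X 0 ω = x} * η := by
  -- Intermediate event ignoring the first `r` customers: passing to it costs the tail sum, passing
  -- from it to stationarity costs the mixing error.
  set B := {ω | X 0 ω = x ∧ (windowSum δ n (fun i => X (r + i) ω)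
        (fun i j => L (r + i) j ω), X (r + n) ω) ∈ A}
  have heq {ω : Ω} (hω : ¬ ∃ i < r, ∃ j, ((n + (r - 1 - i) : ℕ) : ℝ) < L (i + 1) j ω) :
      windowSum δ (r + n) (fun i => X i ω) (fun i j => L i j ω) =
        windowSum δ n (fun i => X (r + i) ω) (fun i j => L (r + i) j ω) := by
    push Not at hω
    exact windowSum_add δ r n (fun i => X i ω) (fun i j => L i j ω) hω
  have h₁ : |μ.real {ω | X 0 ω = x ∧ (windowSum δ (r + n) (fun i => X i ω)
      (fun i j => L i j ω), X (r + n) ω) ∈ A} - μ.real B| ≤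
      ∑' m : ℕ, ∑ j, μ.real {ω | ((m + n : ℕ) : ℝ) < L 0 j ω} := by
    refine (DiscountedQueue.abs_measureReal_sub_le ?_ ?_).trans
      (h.measureReal_exists_lt_le hL r n)
    · intro ω hω
      by_cases hbad : ∃ i < r, ∃ j, ((n + (r - 1 - i) : ℕ) : ℝ) < L (i + 1) j ω
      · exact Or.inr hbad
      · exact Or.inl ⟨hω.1, heq hbad ▸ hω.2⟩
    · intro ω hω
      by_cases hbad : ∃ i < r, ∃ j, ((n + (r - 1 - i) : ℕ) : ℝ) < L (i + 1) j ω
      · exact Or.inr hbad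
      · exact Or.inl ⟨hω.1, (heq hbad).symm ▸ hω.2⟩
  have h₂ := h.measureReal_window_mem δ r n hA (D := {w | w 0 = x})
    (measurableSet_eq_fun (measurable_pi_apply 0) measurable_const)
  have h₃ := h.measureReal_window_mem δ 0 n hA (D := Set.univ) .univ
  simp only [Set.mem_univ, true_and, zero_add] at h₃
  have h₄ := h.chain.abs_setIntegral_window_sub_le x hr
    (Φ := fun b : Fin (n + 1) → State k K => windowProb μ L δ n A (extendPath b x)) fun b => by
      rw [windowProb, abs_of_nonneg measureReal_nonneg]
      exact measureReal_le_one
  have h₅ : μ.real B = ∫ ω in {ω | X 0 ω = x}, windowProb μ L δ n A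
      (extendPath (fun i : Fin (n + 1) => X (r + i) ω) x) ∂μ := by
    refine h₂.trans ?_
    simp only [windowProb_eq_extendPath L δ n A (fun i => X (r + i) _) x]
    rfl
  have h₆ : μ.real {ω | (windowSum δ n (fun i => X i ω) (fun i j => L i j ω), X n ω) ∈ A} =
      ∫ ω, windowProb μ L δ n A (extendPath (fun i : Fin (n + 1) => X i ω) x) ∂μ := by
    rw [h₃]
    simp only [windowProb_eq_extendPath L δ n A (fun i => X i _) x]
    simp
  rw [← h₅, ← h₆] at h₄
  exact (abs_sub_le _ (μ.real B) _).trans (add_le_add h₁ h₄)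

end IsModel


/-! ### The limit law and its mgf. -/

namespace IsModel

variable {Ω : Type*} [MeasurableSpace Ω] {μ : Measure Ω} [IsProbabilityMeasure μ] {k K : ℕ}
  {P : Matrix (State k K) (State k K) ℝ} {X : ℕ → Ω → State k K}
  {L : ℕ → Fin k → Ω → ℝ} {T : ℕ → Ω → ℝ}

/-- The law, given `X 0 = x`, of the discounted queue at time `t` with arrivals at `1, 2, …`. -/
noncomputable def windowLaw (μ : Measure Ω) (X : ℕ → Ω → State k K) (L : ℕ → Fin k → Ω → ℝ)
    (δ : ℝ) (x : State k K) (t : ℕ) : Measure ((Fin k → ℝ) × State k K) :=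
  (condInit μ X x).map fun ω => (windowSum δ t (fun i => X i ω) (fun i j => L i j ω), X t ω)

omit [IsProbabilityMeasure μ] in
theorem measurable_window (h : IsModel μ P X L T) (δ : ℝ) (t : ℕ) :
    Measurable fun ω => (windowSum δ t (fun i => X i ω) (fun i j => L i j ω), X t ω) :=
  (h.measurable_windowSum_path δ t).prodMk (h.chain.measurable t)

theorem isProbabilityMeasure_windowLaw (h : IsModel μ P X L T) (δ : ℝ) (x : State k K) (t : ℕ) :
    IsProbabilityMeasure (windowLaw μ X L δ x t) :=
  have := h.isProbabilityMeasure_condInit x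
  Measure.isProbabilityMeasure_map (h.measurable_window δ t).aemeasurable

omit [IsProbabilityMeasure μ] in
theorem windowLaw_real (h : IsModel μ P X L T) (δ : ℝ) (x : State k K) (t : ℕ)
    {A : Set ((Fin k → ℝ) × State k K)} (hA : MeasurableSet A) :
    (windowLaw μ X L δ x t).real A = (μ.real {ω | X 0 ω = x})⁻¹ *
      μ.real {ω | X 0 ω = x ∧
        (windowSum δ t (fun i => X i ω) (fun i j => L i j ω), X t ω) ∈ A} := by
  rw [windowLaw, map_measureReal_apply (h.measurable_window δ t) hA, measureReal_def, condInit,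
    cond_apply (h.chain.measurableSet_eq 0 x), ENNReal.toReal_mul, ENNReal.toReal_inv]
  rfl

/-- For suitable `n`, all laws at large times lie near one fixed law, the unconditional one at time
`n`; this gives the Cauchy property. -/
theorem exists_tendsto_windowLaw_real (h : IsModel μ P X L T) (δ : ℝ)
    (hL : ∀ j, Integrable (L 0 j) μ) (x : State k K) :
    ∃ ρ : Measure ((Fin k → ℝ) × State k K), IsProbabilityMeasure ρ ∧ ∀ A, MeasurableSet A →
      Tendsto (fun t => (windowLaw μ X L δ x t).real A) atTop (𝓝 (ρ.real A)) := by
  have := h.isProbabilityMeasure_windowLaw δ x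
  refine exists_isProbabilityMeasure_tendsto_real _ fun ε hε => ?_
  have hp := h.chain.init_pos x
  set p := μ.real {ω | X 0 ω = x} with hp_def
  have htail := tendsto_sum_nat_add fun m : ℕ => ∑ j, μ.real {ω | (m : ℝ) < L 0 j ω}
  -- The factor `p` compensates for dividing by `ℙ(X_0 = x)` in the conditional law.
  obtain ⟨n, hn⟩ := (htail.eventually_lt_const (show 0 < p * (ε / 4) by positivity)).exists
  obtain ⟨R, hR⟩ := eventually_atTop.1
    (h.chain.eventually_abs_pow_sub_le x (show 0 < ε / 4 by positivity))
  have key : ∀ t ≥ R + n, ∀ A, MeasurableSet A → |(windowLaw μ X L δ x t).real A -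
      μ.real {ω | (windowSum δ n (fun i => X i ω) (fun i j => L i j ω), X n ω) ∈ A}| ≤
        ε / 2 := by
    intro t ht A hA
    obtain ⟨r, rfl⟩ := Nat.exists_eq_add_of_le' (show n ≤ t by omega)
    have := h.abs_measureReal_sub_le δ hL x (hR r (by omega)) n hA
    rw [h.windowLaw_real δ x _ hA, ← hp_def, ← mul_le_mul_iff_right₀ hp]
    rw [← abs_of_pos hp, ← abs_mul, abs_of_pos hp, mul_sub, mul_inv_cancel_left₀ hp.ne']
    linarith
  refine ⟨R + n, fun t ht t' ht' A hA => ?_⟩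
  have h₁ := abs_le.1 (key t ht A hA)
  have h₂ := abs_le.1 (key t' ht' A hA)
  rw [abs_le]
  constructor <;> linarith

omit [IsProbabilityMeasure μ] in
theorem integral_windowLaw (h : IsModel μ P X L T) (δ : ℝ) (x : State k K) (t : ℕ)
    {f : (Fin k → ℝ) × State k K → ℝ} (hf : Measurable f) :
    ∫ p, f p ∂(windowLaw μ X L δ x t) =
      ∫ ω, f (windowSum δ t (fun i => X i ω) (fun i j => L i j ω), X t ω) ∂(condInit μ X x) :=
  integral_map (h.measurable_window δ t).aemeasurable hf.aestronglyMeasurable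

theorem integrable_windowLaw_exp (h : IsModel μ P X L T) {δ : ℝ} (hδ : 0 ≤ δ) (x : State k K)
    (t : ℕ) (s : Fin k → ℝ) :
    Integrable (fun p => Real.exp (∑ j, s j * p.1 j)) (windowLaw μ X L δ x t) := by
  have := h.isProbabilityMeasure_condInit x
  have hm : Measurable fun p : (Fin k → ℝ) × State k K => Real.exp (∑ j, s j * p.1 j) := by
    fun_prop
  refine (integrable_map_measure hm.aestronglyMeasurable
    (h.measurable_window δ t).aemeasurable).2 ?_
  simpa only [Function.comp_def] using h.integrable_exp_windowSum hδ s t (condInit μ X x)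

theorem exists_integral_windowLaw_exp_le (h : IsModel μ P X L T) {δ : ℝ} (hδ : 0 ≤ δ)
    (hL : ∀ j, Integrable (L 0 j) μ) (x : State k K) (s : Fin k → ℝ) :
    ∃ C, ∀ t, ∫ p, Real.exp (∑ j, s j * p.1 j) ∂(windowLaw μ X L δ x t) ≤ C := by
  obtain ⟨C, hC⟩ := h.exists_integral_exp_windowSum_le hδ hL s
  refine ⟨(μ.real {ω | X 0 ω = x})⁻¹ * C, fun t => ?_⟩
  rw [h.integral_windowLaw δ x t (by fun_prop), integral_condInit]
  have hint := h.integrable_exp_windowSum hδ s t μ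
  gcongr
  exact (setIntegral_le_integral hint (.of_forall fun _ => (Real.exp_pos _).le)).trans (hC t)

theorem continuous_exp_sum_mul (s : Fin k → ℝ) :
    Continuous fun p : (Fin k → ℝ) × State k K => Real.exp (∑ j, s j * p.1 j) := by
  fun_prop

theorem continuous_ite_snd_eq (y : State k K) :
    Continuous fun p : (Fin k → ℝ) × State k K => if p.2 = y then (1 : ℝ) else 0 :=
  (continuous_of_discreteTopology (f := fun v : State k K => if v = y then (1 : ℝ) else 0)).comp
    continuous_snd

/-- As `0 ≤ g ≤ 1`, the squared integrand is dominated by the exponential at `2s`, whose integrals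
are bounded in time. `g` will be the indicator of a final state, or 1. -/
theorem tendsto_integral_windowLaw (h : IsModel μ P X L T) {δ : ℝ} (hδ : 0 ≤ δ)
    (hL : ∀ j, Integrable (L 0 j) μ) (x : State k K)
    {ρ : Measure ((Fin k → ℝ) × State k K)} [IsProbabilityMeasure ρ]
    (hρ : ∀ A, MeasurableSet A →
      Tendsto (fun t => (windowLaw μ X L δ x t).real A) atTop (𝓝 (ρ.real A)))
    (s : Fin k → ℝ) {g : (Fin k → ℝ) × State k K → ℝ} (hg : Continuous g)
    (hg0 : ∀ p, 0 ≤ g p) (hg1 : ∀ p, g p ≤ 1) :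
    Integrable (fun p => Real.exp (∑ j, s j * p.1 j) * g p) ρ ∧
      Tendsto (fun t => ∫ p, Real.exp (∑ j, s j * p.1 j) * g p ∂(windowLaw μ X L δ x t)) atTop
        (𝓝 (∫ p, Real.exp (∑ j, s j * p.1 j) * g p ∂ρ)) := by
  have := h.isProbabilityMeasure_windowLaw δ x
  have hcont := (continuous_exp_sum_mul s).mul hg
  obtain ⟨C, hC⟩ := h.exists_integral_windowLaw_exp_le hδ hL x fun j => 2 * s j
  have hle (p : (Fin k → ℝ) × State k K) :
      (Real.exp (∑ j, s j * p.1 j) * g p) ^ 2 ≤ Real.exp (∑ j, 2 * s j * p.1 j) := by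
    have : ∑ j, 2 * s j * p.1 j = ∑ j, s j * p.1 j + ∑ j, s j * p.1 j := by
      rw [← Finset.sum_add_distrib]
      exact Finset.sum_congr rfl fun j _ => by ring
    rw [this, Real.exp_add, ← sq]
    gcongr
    · exact mul_nonneg (Real.exp_pos _).le (hg0 p)
    · exact mul_le_of_le_one_right (Real.exp_pos _).le (hg1 p)
  have hint (t : ℕ) : Integrable (fun p => (Real.exp (∑ j, s j * p.1 j) * g p) ^ 2)
      (windowLaw μ X L δ x t) := by
    refine (h.integrable_windowLaw_exp hδ x t fun j => 2 * s j).mono'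
      (hcont.pow 2).measurable.aestronglyMeasurable (.of_forall fun p => ?_)
    rw [Real.norm_of_nonneg (sq_nonneg _)]
    exact hle p
  exact tendsto_integral_of_integral_sq_le hρ hcont
    (fun p => mul_nonneg (Real.exp_pos _).le (hg0 p)) hint fun t =>
      (integral_mono (hint t) (h.integrable_windowLaw_exp hδ x t fun j => 2 * s j) hle).trans (hC t)

omit [IsProbabilityMeasure μ] in
theorem psiTilde_apply_eq_integral_windowLaw (h : IsModel μ P X L T) (hτ : ∀ᵐ ω ∂μ, T 1 ω = 1)
    (δ : ℝ) (s : Fin k → ℝ) (t : ℕ) (x y : State k K) :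
    psiTilde μ δ X L T s (t : ℝ) x y = ∫ p, Real.exp (∑ j, s j * p.1 j) *
      (if p.2 = y then 1 else 0) ∂(windowLaw μ X L δ x t) := by
  have hm : Measurable fun p : (Fin k → ℝ) × State k K =>
      Real.exp (∑ j, s j * p.1 j) * if p.2 = y then 1 else 0 :=
    ((continuous_exp_sum_mul s).mul (continuous_ite_snd_eq y)).measurable
  rw [h.integral_windowLaw δ x t hm, psiTilde, Matrix.of_apply]
  refine integral_congr_ae ?_
  filter_upwards [ae_condInit (h.ae_arrival_eq hτ)] with ω hω
  rw [Ztilde_eq_windowSum δ hω, stateAt, arrivals_natCast hω]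

end IsModel

end DiscountedQueue

/-! ### Assembly. -/

theorem mainTheorem1 {Ω : Type*} [MeasurableSpace Ω] (μ : Measure Ω) [IsProbabilityMeasure μ]
    {k K : ℕ} (P : Matrix (DiscountedQueue.State k K) (DiscountedQueue.State k K) ℝ)
    (X : ℕ → Ω → DiscountedQueue.State k K) (L : ℕ → Fin k → Ω → ℝ) (T : ℕ → Ω → ℝ)
    (hmodel : DiscountedQueue.IsModel μ P X L T)
    (δ : ℝ) (hδ : 0 ≤ δ)
    (hτ : ∀ᵐ ω ∂μ, T 1 ω = 1) :
    -- the transient mgf is finite and has a product form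
    (∀ (s : Fin k → ℝ) (t : ℕ),
      (∀ x, Integrable
        (fun ω => Real.exp (∑ j, s j * DiscountedQueue.Ztilde δ X L T (t : ℝ) ω j))
        (DiscountedQueue.condInit μ X x)) ∧
      DiscountedQueue.psiTilde μ δ X L T s (t : ℝ) =
        (DiscountedQueue.orderedProd
          (fun m => DiscountedQueue.Qtilde μ δ P (L 0) s (m : ℝ)) t).transpose ∧
      DiscountedQueue.psiTilde μ δ X L T s (t : ℝ) =
        DiscountedQueue.orderedProd
          (fun m => (DiscountedQueue.Qtilde μ δ P (L 0) s
            ((t : ℝ) - ((m : ℝ) + 1))).transpose) t) ∧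
    -- convergence of the infinite product, and in distribution
    ((∀ j, Integrable (L 0 j) μ) →
      ∃ Qinf : (Fin k → ℝ) →
          Matrix (DiscountedQueue.State k K) (DiscountedQueue.State k K) ℝ,
        (∀ s, Tendsto (fun t : ℕ => DiscountedQueue.orderedProd
            (fun m => DiscountedQueue.Qtilde μ δ P (L 0) s (m : ℝ)) (t + 1))
          atTop (𝓝 (Qinf s))) ∧
        ∀ x : DiscountedQueue.State k K,
          ∃ (_ : IsProbabilityMeasure (DiscountedQueue.condInit μ X x))
            (ν : Measure ((Fin k → ℝ) × DiscountedQueue.State k K))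
            (_ : IsProbabilityMeasure ν),
            TendstoInDistribution
              (fun (t : ℕ) ω => (DiscountedQueue.Ztilde δ X L T (t : ℝ) ω,
                DiscountedQueue.stateAt X T (t : ℝ) ω))
              atTop (fun p => p) (fun _ => DiscountedQueue.condInit μ X x) ν ∧
            ∀ s : Fin k → ℝ,
              Integrable (fun p => Real.exp (∑ j, s j * p.1 j)) ν ∧
              ∀ y : DiscountedQueue.State k K,
                ∫ p, Real.exp (∑ j, s j * p.1 j) * (if p.2 = y then 1 else 0) ∂ν =
                  (Qinf s).transpose x y) := by
  refine ⟨fun s t => ⟨fun x => hmodel.integrable_exp_Ztilde hτ hδ s t x, ?_,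
    hmodel.psiTilde_eq_orderedProd_transpose hτ hδ s t⟩, fun hL => ?_⟩
  · rw [DiscountedQueue.IsModel.transpose_orderedProd_Qtilde]
    exact hmodel.psiTilde_eq_orderedProd_transpose hτ hδ s t
  have hprob (x : DiscountedQueue.State k K) (t : ℕ) := hmodel.isProbabilityMeasure_windowLaw δ x t
  choose ρ hρ hρlim using hmodel.exists_tendsto_windowLaw_real δ hL
  have hite0 (y : DiscountedQueue.State k K) (p : (Fin k → ℝ) × DiscountedQueue.State k K) :
      (0 : ℝ) ≤ if p.2 = y then 1 else 0 := by
    split_ifs <;> norm_num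
  have hite1 (y : DiscountedQueue.State k K) (p : (Fin k → ℝ) × DiscountedQueue.State k K) :
      (if p.2 = y then 1 else 0) ≤ (1 : ℝ) := by
    split_ifs <;> norm_num
  -- The limit matrix is defined from the limit laws, with indices swapped because of the transpose;
  -- the mgf identity is then definitional and only convergence remains.
  refine ⟨fun s => Matrix.of fun y x =>
    ∫ p, Real.exp (∑ j, s j * p.1 j) * (if p.2 = y then 1 else 0) ∂(ρ x), fun s => ?_, fun x => ?_⟩
  · refine tendsto_pi_nhds.2 fun y => tendsto_pi_nhds.2 fun x => ?_
    -- The shift by one is due to partial products whose last factor has index `t`, hence `t + 1`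
    -- factors.
    have key := ((hmodel.tendsto_integral_windowLaw hδ hL x (hρlim x) s
      (DiscountedQueue.IsModel.continuous_ite_snd_eq y) (hite0 y) (hite1 y)).2).comp (tendsto_add_atTop_nat 1)
    refine key.congr fun t => ?_
    rw [Function.comp_apply, ← hmodel.psiTilde_apply_eq_integral_windowLaw hτ,
      hmodel.psiTilde_eq_orderedProd_transpose hτ hδ, ← DiscountedQueue.IsModel.transpose_orderedProd_Qtilde,
      Matrix.transpose_apply]
  · have hcond := hmodel.isProbabilityMeasure_condInit x
    refine ⟨hcond, ρ x, hρ x, ?_, fun s => ⟨?_, fun y => rfl⟩⟩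
    · refine TendstoInDistribution.congr
        (X := fun t ω => (DiscountedQueue.windowSum δ t (fun i => X i ω) (fun i j => L i j ω), X t ω))
        (fun t => DiscountedQueue.IsModel.ae_condInit (hmodel.ae_prodMk_eq hτ δ t).symm) .rfl ?_
      refine ⟨fun t => (hmodel.measurable_window δ t).aemeasurable, aemeasurable_id, ?_⟩
      have hid : (ρ x).map (fun p => p) = ρ x := Measure.map_id
      simp only [hid]
      exact DiscountedQueue.tendsto_probabilityMeasure_of_tendsto_real
        (ν := DiscountedQueue.IsModel.windowLaw μ X L δ x) (hρlim x)
    · simpa using (hmodel.tendsto_integral_windowLaw hδ hL x (hρlim x) s (g := fun _ => 1)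
        continuous_const (fun _ => zero_le_one) fun _ => le_rfl).1
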